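/- All graphs are simple. A decomposition of a graph $K$ into a graph $G$ is a partition of the edge set of $K$ into edge sets of subgraphs of $K$ each isomorphic to $G$; a $G$-design of order $n$ is a decomposition of the complete graph $K_n$ into $G$. Let $n_3, n_6, n_8, n_{10}, n_{13}$ be the graphs with vertex set $\{1,2,3,4,5,6\}$ and edge sets (writing $ab$ for the edge $\{a,b\}$) - $n_3$: $53, 52, 51, 43, 42, 41, 61, 32, 31, 21$; - $n_6$: $62, 63, 61, 52, 53, 51, 42, 43, 41, 21$; - $n_8$: $64, 62, 61, 53, 52, 51, 42, 41, 32, 31$; - $n_{10}$: $43, 42, 45, 41, 61, 32, 35, 31, 25, 21$; - $n_{13}$: $64, 63, 61, 53, 52, 51, 42, 41, 31, 21$. Lemma 3.3. (i) Designs of orders $100$, $140$, $81$, $101$ and $125$ exist for all five graphs $n_3, n_6, n_8, n_{10}, n_{13}$. (ii) Designs of orders $60$ and $80$ exist for each of $n_6$, $n_8$ and $n_{13}$. (iii) Designs of order $61$ exist for each of $n_6$ and $n_8$. (iv) Designs of order $105$ exist for each of $n_3$, $n_6$ and $n_{10}$. (v) Designs of order $96$ exist for each of $n_6$ and $n_8$.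 (vi) Designs of order $136$ exist for each of $n_3$, $n_6$, $n_8$ and $n_{10}$. -/

import Mathlib

/-- A decomposition of the graph `K` into the graph `G`: a set of subgraphs of `K`, each isomorphic
to `G`, whose edge sets partition the edge set of `K`. -/
def HasDecomposition {V W : Type*} (K : SimpleGraph V) (G : SimpleGraph W) : Prop :=
  ∃ P : Set K.Subgraph,
    (∀ H ∈ P, Nonempty (H.coe ≃g G)) ∧ ∀ e ∈ K.edgeSet, ∃! H : K.Subgraph, H ∈ P ∧ e ∈ H.edgeSet

/-- There is a `G`-design of order `n`: a decomposition of the complete graph `K_n` into `G`. -/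
def HasDesign {W : Type*} (G : SimpleGraph W) (n : ℕ) : Prop :=
  HasDecomposition (SimpleGraph.completeGraph (Fin n)) G

/-- The graph with six vertices labelled `1, …, 6` and the listed edges; the vertex labelled `i`
is the element `i - 1` of `Fin 6`. -/
def graphOfEdges (l : List (ℕ × ℕ)) : SimpleGraph (Fin 6) :=
  SimpleGraph.fromRel fun a b => (a.val + 1, b.val + 1) ∈ l

def n3 : SimpleGraph (Fin 6) :=
  graphOfEdges [(5, 3), (5, 2), (5, 1), (4, 3), (4, 2), (4, 1), (6, 1), (3, 2), (3, 1), (2, 1)]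

def n6 : SimpleGraph (Fin 6) :=
  graphOfEdges [(6, 2), (6, 3), (6, 1), (5, 2), (5, 3), (5, 1), (4, 2), (4, 3), (4, 1), (2, 1)]

def n8 : SimpleGraph (Fin 6) :=
  graphOfEdges [(6, 4), (6, 2), (6, 1), (5, 3), (5, 2), (5, 1), (4, 2), (4, 1), (3, 2), (3, 1)]

def n10 : SimpleGraph (Fin 6) :=
  graphOfEdges [(4, 3), (4, 2), (4, 5), (4, 1), (6, 1), (3, 2), (3, 5), (3, 1), (2, 5), (2, 1)]

def n13 : SimpleGraph (Fin 6) :=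
  graphOfEdges [(6, 4), (6, 3), (6, 1), (5, 3), (5, 2), (5, 1), (4, 2), (4, 1), (3, 1), (2, 1)]

/-! Each design is assembled from orbits of copies. A cyclic group of order `m` acts on the points
by translating several runs of `m` consecutive numbers simultaneously and fixing the remaining
points; one base copy of the graph is listed for each orbit of copies. The translates of the base
copies partition the edges of a complete multipartite graph as soon as two things hold: they supply
as many oriented edges as there are ordered pairs of points in different parts, and every orbit of
such pairs is hit. A surjection between finite sets of equal size is a bijection, so disjointness of
the copies, and the fact that they use no edge inside a part, come for free. `tiles_of_isBaseFamily`
is this argument, and `isBaseFamily` is the finite test, evaluated on explicit lists.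

With all parts of size one, except a last part of size at most one, this gives complete graphs
directly. The other orders come from the recursion `Tiles.fill`: a decomposed complete multipartite
graph is completed by designs on its parts, which may all share one extra point. For example 136 =
5·20 + 35 + 1 needs designs of orders 21 and 36. A complete graph with a hole is the special case
where all parts but the last are single points.

All decompositions live on the natural numbers, so that relabelling and union do not change the
vertex type; `Tiles.hasDesign` converts them to subgraphs at the end. -/

/-- The relation `R` on the natural numbers, seen as the edge set of a graph, is partitioned by
copies of `G`. -/
def Tiles {W : Type} (G : SimpleGraph W) (R : ℕ → ℕ → Prop) : Prop :=
  ∃ (ι : Type) (φ : ι → W → ℕ), (∀ i, Function.Injective (φ i)) ∧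
    (∀ i a b, G.Adj a b → R (φ i a) (φ i b)) ∧
    ∀ x y, R x y → ∃! i, ∃ a b, G.Adj a b ∧ φ i a = x ∧ φ i b = y

/-- Adjacency in the complete graph on the natural numbers below `n`. -/
def CompleteRel (n x y : ℕ) : Prop := x ≠ y ∧ x < n ∧ y < n

/-! ### Union and relabelling of tilings, and passage to designs -/

namespace Tiles

variable {W : Type} {G : SimpleGraph W}

theorem congr {R S : ℕ → ℕ → Prop} (h : Tiles G R) (hRS : ∀ x y, R x y ↔ S x y) : Tiles G S := by
  have : R = S := by
    ext x y
    exact hRS x y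
  exact this ▸ h

theorem iUnion {J : Type} {R : J → ℕ → ℕ → Prop} (h : ∀ j, Tiles G (R j))
    (hdisj : ∀ j k x y, R j x y → R k x y → j = k) : Tiles G fun x y => ∃ j, R j x y := by
  choose ι φ hinj hmem hcov using h
  refine ⟨Σ j, ι j, fun p => φ p.1 p.2, fun p => hinj p.1 p.2,
    fun p a b hab => ⟨p.1, hmem p.1 p.2 a b hab⟩, ?_⟩
  rintro x y ⟨j, hj⟩
  obtain ⟨i, hi, huniq⟩ := hcov j x y hj
  refine ⟨⟨j, i⟩, hi, ?_⟩
  rintro ⟨k, l⟩ ⟨a, b, hab, rfl, rfl⟩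
  obtain rfl := hdisj k j _ _ (hmem k l a b hab) hj
  rw [huniq l ⟨a, b, hab, rfl, rfl⟩]

theorem map {R : ℕ → ℕ → Prop} (h : Tiles G R) {f : ℕ → ℕ} (hf : Function.Injective f) :
    Tiles G fun x y => ∃ u v, R u v ∧ f u = x ∧ f v = y := by
  obtain ⟨ι, φ, hinj, hmem, hcov⟩ := h
  refine ⟨ι, fun i a => f (φ i a), fun i => hf.comp (hinj i),
    fun i a b hab => ⟨_, _, hmem i a b hab, rfl, rfl⟩, ?_⟩
  rintro _ _ ⟨u, v, huv, rfl, rfl⟩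
  obtain ⟨i, ⟨a, b, hab, rfl, rfl⟩, huniq⟩ := hcov u v huv
  refine ⟨i, ⟨a, b, hab, rfl, rfl⟩, ?_⟩
  rintro l ⟨c, d, hcd, hc, hd⟩
  exact huniq l ⟨c, d, hcd, hf hc, hf hd⟩

/-- `Tiles` only constrains the ends of edges. Having no isolated vertex forces every vertex of a
copy below `n`, so that the copies really are subgraphs on `Fin n`. -/
theorem hasDesign {n : ℕ} (h : Tiles G (CompleteRel n)) (hG : ∀ a, ∃ b, G.Adj a b) :
    HasDesign G n := by
  obtain ⟨ι, φ, hinj, hmem, hcov⟩ := h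
  have hlt : ∀ i a, φ i a < n := fun i a => by
    obtain ⟨b, hb⟩ := hG a
    exact (hmem i a b hb).2.1
  let ψ : ι → W → Fin n := fun i a => ⟨φ i a, hlt i a⟩
  have hψ : ∀ i, Function.Injective (ψ i) := fun i a b hab => hinj i (congrArg Fin.val hab)
  let H : ι → (SimpleGraph.completeGraph (Fin n)).Subgraph := fun i =>
    { verts := Set.range (ψ i)
      Adj := fun x y => ∃ a b, G.Adj a b ∧ ψ i a = x ∧ ψ i b = y
      adj_sub := by
        rintro x y ⟨a, b, hab, rfl, rfl⟩
        exact (hψ i).ne hab.ne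
      edge_vert := by
        rintro x y ⟨a, b, hab, rfl, rfl⟩
        exact ⟨a, rfl⟩
      symm := ⟨by
        rintro x y ⟨a, b, hab, hx, hy⟩
        exact ⟨b, a, hab.symm, hy, hx⟩⟩ }
  refine ⟨Set.range H, ?_, ?_⟩
  · rintro _ ⟨i, rfl⟩
    refine ⟨(RelIso.mk (Equiv.ofInjective (ψ i) (hψ i)) ?_ : G ≃g (H i).coe).symm⟩
    intro a b
    constructor
    · rintro ⟨c, d, hcd, hc, hd⟩
      obtain rfl := hψ i hc
      obtain rfl := hψ i hd
      exact hcd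
    · exact fun hab => ⟨a, b, hab, rfl, rfl⟩
  · intro e
    induction e using Sym2.ind with
    | _ x y =>
      intro hxy
      have hne : (x : ℕ) ≠ y := fun h => hxy (Fin.ext h)
      obtain ⟨i, ⟨a, b, hab, ha, hb⟩, huniq⟩ := hcov x y ⟨hne, x.2, y.2⟩
      refine ⟨H i, ⟨⟨i, rfl⟩, a, b, hab, Fin.ext ha, Fin.ext hb⟩, ?_⟩
      rintro _ ⟨⟨l, rfl⟩, c, d, hcd, hc, hd⟩
      rw [huniq l ⟨c, d, hcd, congrArg Fin.val hc, congrArg Fin.val hd⟩]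

end Tiles

/-! ### Complete multipartite graphs and filling of their parts -/

/-- The index of the part containing `x` in the partition of the natural numbers into `a` parts of
size `g` and one last part. -/
def partIndex (a g x : ℕ) : ℕ := if x < a * g then x / g else a

/-- Adjacency in the complete multipartite graph on the natural numbers below `a * g + h`, with `a`
parts of size `g` and one part of size `h`. -/
def MultipartiteRel (a g h x y : ℕ) : Prop :=
  partIndex a g x ≠ partIndex a g y ∧ x < a * g + h ∧ y < a * g + h

theorem partIndex_of_lt {a g x : ℕ} (hx : x < a * g) : partIndex a g x = x / g := if_pos hx

theorem partIndex_of_le {a g x : ℕ} (hx : a * g ≤ x) : partIndex a g x = a := if_neg hx.not_gt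

theorem partIndex_lt {a g x : ℕ} (hx : x < a * g) : partIndex a g x < a := by
  rw [partIndex_of_lt hx]
  exact Nat.div_lt_of_lt_mul (by rwa [mul_comm] at hx)

theorem partIndex_le (a g x : ℕ) : partIndex a g x ≤ a := by
  rcases lt_or_ge x (a * g) with h | h
  · exact (partIndex_lt h).le
  · exact (partIndex_of_le h).le

theorem partIndex_add {a g k u : ℕ} (hk : k < a) (hu : u < g) : partIndex a g (k * g + u) = k := by
  have : k * g + u < a * g := by nlinarith
  rw [partIndex_of_lt this, mul_comm, Nat.mul_add_div (by omega), Nat.div_eq_of_lt hu, add_zero]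

/-- The points of the part with index `k`, together with `w` further points, are relabelled. -/
def partEmb (a g h k x : ℕ) : ℕ :=
  if k < a then (if x < g then k * g + x else x - g + (a * g + h)) else x + a * g

theorem partEmb_injective (a g h k : ℕ) : Function.Injective (partEmb a g h k) := by
  intro x y hxy
  unfold partEmb at hxy
  by_cases hk : k < a
  · have : k * g + g ≤ a * g := by nlinarith
    simp only [hk, if_true] at hxy
    split_ifs at hxy <;> omega
  · simp only [hk, if_false] at hxy
    omega

/-- Filling the parts of a decomposition of a complete multipartite graph, possibly after adding one
common point to all parts. -/
theorem Tiles.fill {W : Type} {G : SimpleGraph W} {a g h w : ℕ} (hw : w ≤ 1)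
    (hm : Tiles G (MultipartiteRel a g h)) (hg : Tiles G (CompleteRel (g + w)))
    (hh : Tiles G (CompleteRel (h + w))) : Tiles G (CompleteRel (a * g + h + w)) := by
  -- The index `none` stands for the multipartite edges, and `some k` for the edges inside part `k`
  -- together with the `w` extra points.
  let R : Option (Fin (a + 1)) → ℕ → ℕ → Prop := fun j => j.elim (MultipartiteRel a g h) fun k x y =>
    ∃ u v, CompleteRel ((if k.1 < a then g else h) + w) u v ∧ partEmb a g h k u = x ∧
      partEmb a g h k v = y
  have hR : ∀ j, Tiles G (R j) := by
    rintro (_ | k)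
    · exact hm
    · refine Tiles.map ?_ (partEmb_injective a g h k)
      split_ifs
      · exact hg
      · exact hh
  -- A point coming from the filled part `k` either lies in part `k` or is the unique extra point,
  -- which is the last local label. Since `w ≤ 1`, every edge of a filled part has an end of the
  -- first kind, and that end determines `k`. Two shared points would break this: the edge joining
  -- them would be covered once for each part.
  have key : ∀ (k : Fin (a + 1)) (u : ℕ), u < (if k.1 < a then g else h) + w →
      (partEmb a g h k u < a * g + h ∧ partIndex a g (partEmb a g h k u) = k) ∨
        partEmb a g h k u = a * g + h ∧ u = if k.1 < a then g else h := by
    intro k u hu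
    unfold partEmb
    by_cases hk : k.1 < a
    · simp only [hk, if_true] at hu ⊢
      by_cases hug : u < g
      · simp only [hug, if_true]
        refine Or.inl ⟨?_, partIndex_add hk hug⟩
        nlinarith
      · simp only [hug, if_false]
        omega
    · simp only [hk, if_false] at hu ⊢
      by_cases huh : u < h
      · refine Or.inl ⟨by omega, ?_⟩
        rw [partIndex_of_le (by omega)]
        omega
      · omega
  refine (Tiles.iUnion hR ?_).congr ?_
  · rintro (_ | j) (_ | k) x y hj hk
    · rfl
    · obtain ⟨u, v, huv, rfl, rfl⟩ := hk
      obtain ⟨h1, h2, h3⟩ := hj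
      rcases key k u huv.2.1 with h4 | h4 <;> rcases key k v huv.2.2 with h5 | h5 <;> omega
    · obtain ⟨u, v, huv, rfl, rfl⟩ := hj
      obtain ⟨h1, h2, h3⟩ := hk
      rcases key j u huv.2.1 with h4 | h4 <;> rcases key j v huv.2.2 with h5 | h5 <;> omega
    · obtain ⟨u, v, huv, rfl, rfl⟩ := hj
      obtain ⟨u', v', huv', hu, hv⟩ := hk
      have h1 := huv.1
      congr 1
      refine Fin.ext ?_
      rcases key j u huv.2.1 with h4 | h4 <;> rcases key j v huv.2.2 with h5 | h5 <;>
        rcases key k u' huv'.2.1 with h6 | h6 <;> rcases key k v' huv'.2.2 with h7 | h7 <;>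
        rw [hu] at h6 <;> rw [hv] at h7 <;> omega
  · intro x y
    constructor
    · rintro ⟨_ | k, hj⟩
      · obtain ⟨h1, h2, h3⟩ := hj
        exact ⟨fun h => h1 (h ▸ rfl), by omega, by omega⟩
      · obtain ⟨u, v, huv, rfl, rfl⟩ := hj
        refine ⟨(partEmb_injective a g h k).ne huv.1, ?_, ?_⟩
        · have := key k u huv.2.1
          have := huv.2.1
          split_ifs at * <;> omega
        · have := key k v huv.2.2
          have := huv.2.2
          split_ifs at * <;> omega
    · rintro ⟨hne, hx, hy⟩
      -- Conversely, each point other than the extra one has a preimage in its own part.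
      have pre : ∀ z, z < a * g + h → ∃ u, u < (if partIndex a g z < a then g else h) ∧
          partEmb a g h (partIndex a g z) u = z := by
        intro z hz
        unfold partEmb
        by_cases hza : z < a * g
        · have hlt := partIndex_lt hza
          rw [partIndex_of_lt hza] at hlt ⊢
          have hg0 : 0 < g := Nat.pos_of_ne_zero fun h0 => by simp [h0] at hza
          refine ⟨z % g, by simpa [hlt] using Nat.mod_lt z hg0, ?_⟩
          simp only [hlt, Nat.mod_lt z hg0, if_true]
          exact Nat.div_add_mod' z g
        · rw [partIndex_of_le (by omega)]
          refine ⟨z - a * g, ?_, ?_⟩ <;> simp only [lt_irrefl, if_false] <;> omega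
      have last : ∀ k, partEmb a g h k (if k < a then g else h) = a * g + h := by
        intro k
        unfold partEmb
        split_ifs <;> omega
      -- An edge avoiding the extra point is multipartite or lies inside one part; an edge at the
      -- extra point belongs to the part of its other end.
      by_cases hx' : x < a * g + h <;> by_cases hy' : y < a * g + h
      · by_cases hp : partIndex a g x = partIndex a g y
        · obtain ⟨u, hu, hux⟩ := pre x hx'
          obtain ⟨v, hv, hvy⟩ := pre y hy'
          rw [← hp] at hv hvy
          exact ⟨some ⟨partIndex a g x, by have := partIndex_le a g x; omega⟩, u, v,
            ⟨by rintro rfl; exact hne (hux.symm.trans hvy), hu.trans_le (Nat.le_add_right _ _),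
              hv.trans_le (Nat.le_add_right _ _)⟩, hux, hvy⟩
        · exact ⟨none, hp, hx', hy'⟩
      · obtain ⟨u, hu, hux⟩ := pre x hx'
        exact ⟨some ⟨partIndex a g x, by have := partIndex_le a g x; omega⟩, u, _,
            ⟨hu.ne, hu.trans_le (Nat.le_add_right _ _), Nat.lt_add_of_pos_right (by omega)⟩,
            hux, (last _).trans (by omega)⟩
      · obtain ⟨u, hu, hux⟩ := pre y hy'
        exact ⟨some ⟨partIndex a g y, by have := partIndex_le a g y; omega⟩, _, u,
            ⟨hu.ne', Nat.lt_add_of_pos_right (by omega), hu.trans_le (Nat.le_add_right _ _)⟩,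
            (last _).trans (by omega), hux⟩
      · omega

theorem Tiles.complete_of_le_one {W : Type} (G : SimpleGraph W) {n : ℕ} (hn : n ≤ 1) :
    Tiles G (CompleteRel n) :=
  ⟨Empty, fun i => i.elim, fun i => i.elim, fun i => i.elim,
    fun x y hxy => absurd hxy.1 (by have := hxy.2; omega)⟩

/-! ### The cyclic action by translation -/

/-- Translation by `s` inside each block of `m` consecutive numbers below `T`, a multiple of `m`;
the numbers from `T` on are fixed. -/
def shift (m T s x : ℕ) : ℕ :=
  bif Nat.ble T x then x else x / m * m + (x + s) % m

theorem shift_of_le {m T s x : ℕ} (h : T ≤ x) : shift m T s x = x := by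
  have : Nat.ble T x = true := Nat.ble_eq_true_of_le h
  rw [shift, this, cond_true]

theorem shift_of_lt {m T s x : ℕ} (h : x < T) : shift m T s x = x / m * m + (x + s) % m := by
  have : Nat.ble T x = false :=
    Bool.eq_false_iff.2 fun h' => h.not_ge (Nat.le_of_ble_eq_true h')
  rw [shift, this, cond_false]

theorem mul_div_add_mod_lt {m T x r : ℕ} (hm : 0 < m) (hT : m ∣ T) (hx : x < T) :
    x / m * m + r % m < T := by
  obtain ⟨t, rfl⟩ := hT
  have h1 : x / m < t := Nat.div_lt_of_lt_mul hx
  have h2 := Nat.mod_lt r hm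
  nlinarith

theorem mul_div_add_mod_div {m : ℕ} (hm : 0 < m) (x r : ℕ) :
    (x / m * m + r % m) / m = x / m := by
  rw [mul_comm, Nat.mul_add_div hm, Nat.div_eq_of_lt (Nat.mod_lt r hm), add_zero]

/-- A run of `m` consecutive numbers starting at a multiple of `m` never straddles `S`, and
translation keeps each point in its run. -/
theorem shift_lt_iff {m T S s x : ℕ} (hm : 0 < m) (hS : m ∣ S) : shift m T s x < S ↔ x < S := by
  rcases lt_or_ge x T with h | h
  · rw [shift_of_lt h]
    refine ⟨fun hx => ?_, mul_div_add_mod_lt hm hS⟩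
    have h2 := mul_div_add_mod_lt (r := x) hm hS hx
    rwa [mul_div_add_mod_div hm, Nat.div_add_mod'] at h2
  · rw [shift_of_le h]

theorem shift_shift {m T s r x : ℕ} (hm : 0 < m) (hT : m ∣ T) :
    shift m T r (shift m T s x) = shift m T (s + r) x := by
  rcases lt_or_ge x T with h | h
  · rw [shift_of_lt ((shift_lt_iff hm hT).2 h), shift_of_lt h, shift_of_lt h,
      mul_div_add_mod_div hm]
    have h2 : x / m * m + (x + s) % m + r ≡ x + (s + r) [MOD m] := by
      have h3 : x / m * m + (x + s) % m ≡ 0 + (x + s) [MOD m] :=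
        (Nat.modEq_zero_iff_dvd.2 (Nat.dvd_mul_left m _)).add (Nat.mod_modEq _ _)
      simpa [Nat.add_assoc] using h3.add_right r
    rw [h2]
  · rw [shift_of_le h, shift_of_le h, shift_of_le h]

theorem shift_of_dvd {m T s x : ℕ} (hs : m ∣ s) : shift m T s x = x := by
  rcases lt_or_ge x T with h | h
  · rw [shift_of_lt h, Nat.add_mod, Nat.mod_eq_zero_of_dvd hs, add_zero, Nat.mod_mod,
      Nat.div_add_mod']
  · exact shift_of_le h

theorem shift_mod {m T s x : ℕ} : shift m T (s % m) x = shift m T s x := by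
  rcases lt_or_ge x T with h | h
  · rw [shift_of_lt h, shift_of_lt h, Nat.add_mod_mod]
  · rw [shift_of_le h, shift_of_le h]

theorem shift_injective {m T : ℕ} (hm : 0 < m) (hT : m ∣ T) (s : ℕ) :
    Function.Injective (shift m T s) := by
  intro x y hxy
  -- The number `m - s % m` plays the role of `-s`. When `m ∣ s` it equals `m`, which also acts
  -- trivially.
  have h2 : ∀ z, shift m T (m - s % m) (shift m T s z) = z := fun z => by
    rw [shift_shift hm hT]
    refine shift_of_dvd ?_
    have h3 := Nat.mod_lt s hm
    have h4 := Nat.div_add_mod s m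
    exact ⟨s / m + 1, by rw [mul_add, mul_one]; omega⟩
  rw [← h2 x, hxy, h2]

theorem shift_neg_self {m T x : ℕ} (hm : 0 < m) (hx : x < T) :
    shift m T (m - x % m) x = x / m * m := by
  have h3 := Nat.mod_lt x hm
  have h4 := Nat.div_add_mod x m
  have : x + (m - x % m) = m * (x / m + 1) := by rw [mul_add, mul_one]; omega
  rw [shift_of_lt hx, this, Nat.mul_mod_right, add_zero]

theorem shift_mod_shift_neg {m T x y : ℕ} (hm : 0 < m) (hT : m ∣ T) :
    shift m T (x % m) (shift m T (m - x % m) y) = y := by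
  have h3 := Nat.mod_lt x hm
  rw [shift_shift hm hT]
  exact shift_of_dvd ⟨1, by omega⟩

/-- For `g = 1` the parts below `a` are points, which the translation permutes. For `m ∣ g` each run
lies inside one part, so every part is preserved. In both cases `m ∣ a * g` keeps the last part
stable; it may contain both moved and fixed points. -/
theorem partIndex_shift_eq_iff {m T a g s x y : ℕ} (hm : 0 < m) (hT : m ∣ T)
    (hg : g = 1 ∨ m ∣ g) (ha : m ∣ a * g)
    (haT : a * g ≤ T) :
    partIndex a g (shift m T s x) = partIndex a g (shift m T s y) ↔
      partIndex a g x = partIndex a g y := by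
  rcases hg with rfl | hg
  · rw [mul_one] at ha haT
    simp only [partIndex, mul_one, shift_lt_iff hm ha, Nat.div_one]
    split_ifs with h1 h2 h2
    · exact (shift_injective hm hT s).eq_iff
    · have := (shift_lt_iff (T := T) (s := s) hm ha).2 h1
      omega
    · have := (shift_lt_iff (T := T) (s := s) hm ha).2 h2
      omega
    · rfl
  · have h1 : ∀ z, partIndex a g (shift m T s z) = partIndex a g z := fun z => by
      simp only [partIndex, shift_lt_iff hm ha]
      split_ifs with h2
      · obtain ⟨c, rfl⟩ := hg
        rw [shift_of_lt (h2.trans_le haT), ← Nat.div_div_eq_div_mul, mul_div_add_mod_div hm,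
          Nat.div_div_eq_div_mul]
      · rfl
    rw [h1, h1]

/-! ### Orbits of ordered pairs, counting, and the base family test -/

/-- A code for the orbit of the pair `(x, y)` under translation. -/
def dartCode (m T n x y : ℕ) : ℕ := x / m * n + shift m T (m - x % m) y

/-- The code records the pair after translating its first point to the start of its run: the
quotient by `n` is the run number and the remainder is the translated second point. Equal codes
therefore mean equal normal forms, and translating one pair to the normal form and back to the other
gives `s`. -/
theorem exists_shift_of_dartCode_eq {m T n u v x y : ℕ} (hm : 0 < m) (hT : m ∣ T) (hTn : T ≤ n)
    (hx : x < T) (hv : v < n) (hy : y < n) (h : dartCode m T n u v = dartCode m T n x y) :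
    ∃ s < m, shift m T s u = x ∧ shift m T s v = y := by
  have hlt : ∀ {z s}, z < n → shift m T s z < n := fun {z s} hz => by
    rcases lt_or_ge z T with h | h
    · exact ((shift_lt_iff hm hT).2 h).trans_le hTn
    · rwa [shift_of_le h]
  have hdiv : u / m = x / m := by
    have := congrArg (· / n) h
    simpa [dartCode, mul_comm _ n, Nat.mul_add_div (by omega : 0 < n),
      Nat.div_eq_of_lt (hlt hv), Nat.div_eq_of_lt (hlt hy)] using this
  have hmod : shift m T (m - u % m) v = shift m T (m - x % m) y := by
    unfold dartCode at h
    rw [hdiv] at h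
    omega
  -- A fixed first point has a run number of at least `T / m`, so its code cannot agree with that of
  -- a pair starting below `T`.
  have hu : u < T := by
    obtain ⟨t, rfl⟩ := hT
    have h1 : u / m < t := hdiv ▸ Nat.div_lt_of_lt_mul hx
    rw [mul_comm]
    exact (Nat.div_lt_iff_lt_mul hm).1 h1
  refine ⟨(m - u % m + x % m) % m, Nat.mod_lt _ hm, ?_, ?_⟩
  · rw [shift_mod, ← shift_shift hm hT, shift_neg_self hm hu, hdiv,
      ← shift_neg_self hm hx, shift_mod_shift_neg hm hT]
  · rw [shift_mod, ← shift_shift hm hT, hmod, shift_mod_shift_neg hm hT]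

theorem testBit_foldr_lor {α : Type} (f : α → ℕ) (l : List α) (i : ℕ) :
    (l.foldr (fun b M => M ||| f b) 0).testBit i = true ↔ ∃ b ∈ l, (f b).testBit i = true := by
  induction l with
  | nil => simp
  | cons b l ih => simp [ih, or_comm]

/-- The ordered pairs inside a common part form `a` squares of side `g` and one of side `h`, the
diagonal being included. -/
theorem card_multipartiteRel (a g h : ℕ) [DecidableRel (MultipartiteRel a g h)] :
    ((Finset.range (a * g + h) ×ˢ Finset.range (a * g + h)).filter
      fun p => MultipartiteRel a g h p.1 p.2).card + (a * g * g + h * h) =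
      (a * g + h) * (a * g + h) := by
  set n := a * g + h with hn
  have h1 : ((Finset.range n ×ˢ Finset.range n).filter
      fun p => ¬ MultipartiteRel a g h p.1 p.2).card = a * g * g + h * h := by
    have h2 : ((Finset.range n ×ˢ Finset.range n).filter
        fun p => ¬ MultipartiteRel a g h p.1 p.2).card =
        ∑ x ∈ Finset.range n, ((Finset.range n).filter
          fun y => partIndex a g y = partIndex a g x).card := by
      rw [Finset.card_filter, Finset.sum_product]
      refine Finset.sum_congr rfl fun x hx => ?_
      rw [Finset.card_filter]
      refine Finset.sum_congr rfl fun y hy => ?_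
      rw [Finset.mem_range] at hx hy
      refine if_congr ?_ rfl rfl
      simp only [MultipartiteRel, ← hn, hx, hy, and_true, not_not]
      exact eq_comm
    rw [h2, hn, Finset.sum_range_add, ← hn]
    congr 1
    · rw [Finset.sum_congr rfl (g := fun _ => g), Finset.sum_const, Finset.card_range, smul_eq_mul]
      intro x hx
      rw [Finset.mem_range] at hx
      have hlt := partIndex_lt hx
      set k := partIndex a g x
      have hkg : k * g + g ≤ a * g := by nlinarith
      have : ((Finset.range n).filter fun y => partIndex a g y = k) =
          Finset.Ico (k * g) (k * g + g) := by
        ext y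
        simp only [Finset.mem_filter, Finset.mem_range, Finset.mem_Ico]
        constructor
        · rintro ⟨_, hy⟩
          have hya : y < a * g := by
            by_contra hya
            rw [partIndex_of_le (not_lt.1 hya)] at hy
            omega
          rw [partIndex_of_lt hya] at hy
          have hg0 : 0 < g := Nat.pos_of_ne_zero fun h0 => by simp [h0] at hya
          have h3 := Nat.div_add_mod' y g
          have h4 := Nat.mod_lt y hg0
          rw [hy] at h3
          omega
        · rintro ⟨h3, h4⟩
          refine ⟨by omega, ?_⟩
          have := partIndex_add (a := a) hlt (by omega : y - k * g < g)
          rwa [Nat.add_sub_cancel' h3] at this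
      rw [this, Nat.card_Ico, Nat.add_sub_cancel_left]
    · rw [Finset.sum_congr rfl (g := fun _ => h), Finset.sum_const, Finset.card_range, smul_eq_mul]
      intro x _
      have : ((Finset.range n).filter fun y => partIndex a g y = partIndex a g (a * g + x)) =
          Finset.Ico (a * g) n := by
        ext y
        rw [partIndex_of_le (Nat.le_add_right _ _), Finset.mem_filter, Finset.mem_range,
          Finset.mem_Ico]
        constructor
        · rintro ⟨h3, h4⟩
          refine ⟨?_, h3⟩
          by_contra hya
          have := partIndex_lt (not_le.1 hya)
          omega
        · exact fun h3 => ⟨h3.2, partIndex_of_le h3.1⟩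
      rw [this, Nat.card_Ico, hn, Nat.add_sub_cancel_left]
  rw [← h1, Finset.card_filter_add_card_filter_not, Finset.card_product, Finset.card_range]

/-- The codes, as bits of a number, of the pairs of points that are joined by an edge in one of the
blocks of `L`, where `E` lists the edges by the positions (from `1`) of their ends in a block. -/
def dartMask (m T n : ℕ) (E : List (ℕ × ℕ)) (L : List (List ℕ)) : ℕ :=
  L.foldr (fun b M => M ||| E.foldr (fun e M => M |||
    (2 ^ dartCode m T n (b.getD (e.1 - 1) 0) (b.getD (e.2 - 1) 0) |||
      2 ^ dartCode m T n (b.getD (e.2 - 1) 0) (b.getD (e.1 - 1) 0))) 0) 0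

/-- A test that the translates of the blocks in `L` partition the complete multipartite graph with
`a` parts of size `g` and one part of size `h` into copies of the graph with edge list `E`. -/
def isBaseFamily (m t a g h : ℕ) (E : List (ℕ × ℕ)) (L : List (List ℕ)) : Bool :=
  decide (0 < m ∧ (g = 1 ∨ m ∣ g) ∧ m ∣ a * g ∧ a * g ≤ t * m ∧ t * m ≤ a * g + h ∧
    -- The count of oriented edges: each base block has `m` translates, and each edge of a copy has
    -- two orientations.
    L.length * (m * (E.length * 2)) + (a * g * g + h * h) = (a * g + h) * (a * g + h) ∧
    (∀ e ∈ E, 1 ≤ e.1 ∧ e.1 ≤ 6 ∧ 1 ≤ e.2 ∧ e.2 ≤ 6 ∧ e.1 ≠ e.2) ∧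
    ∀ b ∈ L, b.length = 6 ∧ b.Nodup ∧ ∀ x ∈ b, x < a * g + h) &&
  -- Every multipartite edge has an end below `a * g`, so it suffices to test pairs whose first
  -- point is the start `o * m` of a run there. Such a pair is its own normal form, with code `o *
  -- (a * g + h) + y`.
  (List.range (a * g / m)).all fun o => (List.range (a * g + h)).all fun y =>
    Nat.beq (partIndex a g (o * m)) (partIndex a g y) ||
      (dartMask m (t * m) (a * g + h) E L).testBit (o * (a * g + h) + y)

theorem graphOfEdges_adj {E : List (ℕ × ℕ)} {i j : Fin 6} :
    (graphOfEdges E).Adj i j ↔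
      i ≠ j ∧ ((i.val + 1, j.val + 1) ∈ E ∨ (j.val + 1, i.val + 1) ∈ E) :=
  SimpleGraph.fromRel_adj _ _ _

/-- The oriented edges of all translated blocks are indexed by `I`. The bit test shows that they
exhaust the set `D` of multipartite pairs, and the count shows that `I` and `D` have equal size.
Hence `F` is a bijection onto `D`: surjectivity gives covering, landing in `D` says that no edge is
misplaced, and injectivity gives uniqueness of the covering copy. -/
theorem tiles_of_isBaseFamily {E : List (ℕ × ℕ)} (m t a g h : ℕ) (L : List (List ℕ))
    (hL : isBaseFamily m t a g h E L = true) :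
    Tiles (graphOfEdges E) (MultipartiteRel a g h) := by
  classical
  rw [isBaseFamily, Bool.and_eq_true, decide_eq_true_eq] at hL
  obtain ⟨⟨hm, hg, ha, haT, hTn, hcard, hE, hb⟩, hcov⟩ := hL
  set n := a * g + h with hn
  set T := t * m with hT'
  have hT : m ∣ T := Dvd.intro_left t rfl
  have hmask : ∀ o < a * g / m, ∀ y < n, partIndex a g (o * m) ≠ partIndex a g y →
      (dartMask m T n E L).testBit (o * n + y) = true := by
    intro o ho y hy hne
    have h1 := List.all_eq_true.1 (List.all_eq_true.1 hcov o (List.mem_range.2 ho)) y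
      (List.mem_range.2 hy)
    rw [Bool.or_eq_true] at h1
    exact h1.resolve_left fun h2 => hne (Nat.eq_of_beq_eq_true h2)
  let blk : Fin L.length → ℕ → ℕ := fun i v => (L.get i).getD v 0
  have hblk : ∀ i v, v < 6 → blk i v < n := fun i v hv => by
    obtain ⟨h1, h2, h3⟩ := hb _ (List.get_mem L i)
    have hv' : v < (L.get i).length := by omega
    simp only [blk, List.getD_eq_getElem _ _ hv']
    exact h3 _ (List.getElem_mem hv')
  have hblk_inj : ∀ i u v, u < 6 → v < 6 → blk i u = blk i v → u = v := fun i u v hu hv huv => by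
    obtain ⟨h1, h2, h3⟩ := hb _ (List.get_mem L i)
    have hu' : u < (L.get i).length := by omega
    have hv' : v < (L.get i).length := by omega
    simp only [blk, List.getD_eq_getElem _ _ hv', List.getD_eq_getElem _ _ hu'] at huv
    exact (List.Nodup.getElem_inj_iff h2).1 huv
  -- An index consists of a base block, a translation, an edge of the model graph and an orientation
  -- of it.
  let I := Fin L.length × Fin m × Fin E.length × Bool
  let F : I → ℕ × ℕ := fun p =>
    let e := E.get p.2.2.1
    let x := shift m T p.2.1 (blk p.1 (e.1 - 1))
    let y := shift m T p.2.1 (blk p.1 (e.2 - 1))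
    bif p.2.2.2 then (x, y) else (y, x)
  let D := (Finset.range n ×ˢ Finset.range n).filter fun p => MultipartiteRel a g h p.1 p.2
  have hDF' : ∀ x y, MultipartiteRel a g h x y → x < a * g → ∃ p, F p = (x, y) := by
    rintro x y ⟨hne, hx, hy⟩ hxa
    have hxT : x < T := hxa.trans_le haT
    have hy' : shift m T (m - x % m) y < n := by
      rcases lt_or_ge y T with h | h
      · exact ((shift_lt_iff hm hT).2 h).trans_le hTn
      · rwa [shift_of_le h]
    -- The pair is translated by `-x` to its normal form, where the mask applies. The translation
    -- preserves the property of lying in different parts.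
    have hbit := hmask (x / m) (Nat.div_lt_div_of_lt_of_dvd ha hxa) _ hy' (by
      rw [← shift_neg_self hm hxT]
      exact fun h1 => hne ((partIndex_shift_eq_iff hm hT hg ha haT).1 h1))
    obtain ⟨b, hbL, hbit⟩ := (testBit_foldr_lor _ _ _).1 hbit
    obtain ⟨e, heE, hbit⟩ := (testBit_foldr_lor _ _ _).1 hbit
    obtain ⟨i, rfl⟩ := List.get_of_mem hbL
    obtain ⟨k, rfl⟩ := List.get_of_mem heE
    obtain ⟨he1, he2, he3, he4, -⟩ := hE _ (List.get_mem E k)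
    rw [Nat.testBit_or, Bool.or_eq_true, Nat.testBit_two_pow, Nat.testBit_two_pow,
      decide_eq_true_eq, decide_eq_true_eq] at hbit
    rcases hbit with hbit | hbit
    · obtain ⟨s, hs, h1, h2⟩ := exists_shift_of_dartCode_eq hm hT hTn hxT
        (hblk i _ (by omega)) hy hbit
      exact ⟨(i, ⟨s, hs⟩, k, true), Prod.ext h1 h2⟩
    · obtain ⟨s, hs, h1, h2⟩ := exists_shift_of_dartCode_eq hm hT hTn hxT
        (hblk i _ (by omega)) hy hbit
      exact ⟨(i, ⟨s, hs⟩, k, false), Prod.ext h1 h2⟩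
  have hDF : ∀ x y, MultipartiteRel a g h x y → ∃ p, F p = (x, y) := by
    intro x y hxy
    by_cases hxa : x < a * g
    · exact hDF' x y hxy hxa
    · have hya : y < a * g := by
        by_contra hya
        exact hxy.1 ((partIndex_of_le (not_lt.1 hxa)).trans (partIndex_of_le (not_lt.1 hya)).symm)
      -- If the first point lies in the last part, the second does not; the reversed pair is
      -- covered, and flipping the orientation bit restores the order.
      obtain ⟨⟨i, s, k, c⟩, hp⟩ := hDF' y x ⟨hxy.1.symm, hxy.2.2, hxy.2.1⟩ hya
      refine ⟨(i, s, k, !c), ?_⟩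
      cases c <;> exact Prod.ext (congrArg Prod.snd hp) (congrArg Prod.fst hp)
  have hsub : D ⊆ Finset.univ.image F := fun p hp => by
    obtain ⟨q, hq⟩ := hDF p.1 p.2 (Finset.mem_filter.1 hp).2
    exact Finset.mem_image.2 ⟨q, Finset.mem_univ _, hq⟩
  have hDcard : D.card = Fintype.card I := by
    have h1 := card_multipartiteRel a g h
    simp only [I, Fintype.card_prod, Fintype.card_fin, Fintype.card_bool]
    change D.card + _ = n * n at h1
    omega
  -- Here counting turns covering into equality, and then into injectivity of `F`.
  have himage : D = Finset.univ.image F :=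
    Finset.eq_of_subset_of_card_le hsub (hDcard ▸ Finset.card_image_le)
  have hFinj : Function.Injective F := by
    have h1 : (Finset.univ.image F).card = (Finset.univ : Finset I).card := by
      rw [← himage, hDcard, Finset.card_univ]
    exact fun p q hpq => Finset.card_image_iff.1 h1 (Finset.mem_coe.2 (Finset.mem_univ p))
      (Finset.mem_coe.2 (Finset.mem_univ q)) hpq
  have hadj : ∀ (p : Fin L.length × Fin m) (u v : Fin 6), (graphOfEdges E).Adj u v →
      ∃ q : Fin E.length × Bool, F (p.1, p.2, q) =
        (shift m T p.2 (blk p.1 u), shift m T p.2 (blk p.1 v)) := by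
    intro p u v huv
    rcases (graphOfEdges_adj.1 huv).2 with h1 | h1
    · obtain ⟨k, hk⟩ := List.get_of_mem h1
      refine ⟨(k, true), ?_⟩
      simp only [F, hk, cond_true, Nat.add_sub_cancel]
    · obtain ⟨k, hk⟩ := List.get_of_mem h1
      refine ⟨(k, false), ?_⟩
      simp only [F, hk, cond_false, Nat.add_sub_cancel]
  refine ⟨Fin L.length × Fin m, fun p v => shift m T p.2 (blk p.1 v), ?_, ?_, ?_⟩
  · exact fun p u v huv =>
      Fin.ext (hblk_inj p.1 u v u.2 v.2 (shift_injective hm hT _ huv))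
  · intro p u v huv
    obtain ⟨q, hq⟩ := hadj p u v huv
    have h1 : F (p.1, p.2, q) ∈ D := himage ▸ Finset.mem_image_of_mem F (Finset.mem_univ _)
    rw [hq] at h1
    exact (Finset.mem_filter.1 h1).2
  · intro x y hxy
    obtain ⟨⟨i, s, k, c⟩, hp⟩ := hDF x y hxy
    refine ⟨(i, s), ?_, ?_⟩
    · obtain ⟨he1, he2, he3, he4, hne⟩ := hE _ (List.get_mem E k)
      have hk : ((E.get k).1 - 1 + 1, (E.get k).2 - 1 + 1) ∈ E := by
        rw [Nat.sub_add_cancel he1, Nat.sub_add_cancel he3]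
        exact List.get_mem E k
      let u : Fin 6 := ⟨(E.get k).1 - 1, by omega⟩
      let v : Fin 6 := ⟨(E.get k).2 - 1, by omega⟩
      have huv : u ≠ v := fun h1 => by
        have := congrArg Fin.val h1
        simp only [u, v] at this
        omega
      have h1 : (graphOfEdges E).Adj u v := graphOfEdges_adj.2 ⟨huv, Or.inl hk⟩
      cases c
      · exact ⟨v, u, h1.symm, congrArg Prod.fst hp, congrArg Prod.snd hp⟩
      · exact ⟨u, v, h1, congrArg Prod.fst hp, congrArg Prod.snd hp⟩
    · rintro ⟨i', s'⟩ ⟨u, v, huv, hu, hv⟩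
      obtain ⟨q, hq⟩ := hadj (i', s') u v huv
      have h1 : F (i', s', q) = F (i, s, k, c) := by
        rw [hq, hp, ← hu, ← hv]
      have h2 := hFinj h1
      rw [Prod.mk.injEq, Prod.mk.injEq] at h2
      rw [h2.1, h2.2.1]

/-- With `g = 1` the multipartite graph is the complete graph with the edges inside an `h`-set
removed. Only that hole needs filling, and no extra point is used. -/
theorem tiles_complete_of_hole {E : List (ℕ × ℕ)} (m t a h : ℕ) (L : List (List ℕ))
    (hL : isBaseFamily m t a 1 h E L = true) (hh : Tiles (graphOfEdges E) (CompleteRel h)) :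
    Tiles (graphOfEdges E) (CompleteRel (a * 1 + h)) :=
  Tiles.fill (w := 0) zero_le_one (tiles_of_isBaseFamily m t a 1 h L hL)
    (Tiles.complete_of_le_one _ le_rfl) hh

theorem tiles_complete {E : List (ℕ × ℕ)} (m t a h : ℕ) (L : List (List ℕ))
    (hL : isBaseFamily m t a 1 h E L = true) (hh : h ≤ 1) :
    Tiles (graphOfEdges E) (CompleteRel (a * 1 + h)) :=
  tiles_complete_of_hole m t a h L hL (Tiles.complete_of_le_one _ hh)

theorem tiles_complete_of_multipartite {E : List (ℕ × ℕ)} (m t a g h w : ℕ)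
    (L : List (List ℕ)) (hL : isBaseFamily m t a g h E L = true) (hw : w ≤ 1)
    (hg : Tiles (graphOfEdges E) (CompleteRel (g + w)))
    (hh : Tiles (graphOfEdges E) (CompleteRel (h + w))) :
    Tiles (graphOfEdges E) (CompleteRel (a * g + h + w)) :=
  (tiles_of_isBaseFamily m t a g h L hL).fill hw hg hh

/-! ### Base blocks for orders 81, 101 and 100 -/

theorem tiles_n3_81 : Tiles n3 (CompleteRel 81) :=
  tiles_complete 81 1 81 0
    [[68, 27, 5, 41, 78, 15], [63, 17, 24, 48, 50, 60], [25, 20, 0, 37, 4, 24],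
     [11, 20, 43, 9, 49, 73]]
    (by decide +kernel) (by norm_num)

theorem tiles_n3_101 : Tiles n3 (CompleteRel 101) :=
  tiles_complete 101 1 101 0
    [[21, 35, 6, 79, 88, 76], [45, 28, 44, 41, 35, 72], [40, 9, 35, 73, 85, 48],
     [20, 8, 62, 86, 26, 59], [27, 7, 76, 87, 5, 67]]
    (by decide +kernel) (by norm_num)

/-- The 495 copies form 5 orbits of length 99, with 99 as the fixed point at infinity. -/
theorem tiles_n3_100 : Tiles n3 (CompleteRel 100) :=
  tiles_complete 99 1 99 1
    [[71, 58, 55, 27, 21, 99], [20, 15, 9, 78, 96, 22], [62, 2, 19, 91, 86, 54],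
     [25, 58, 4, 44, 5, 18], [36, 97, 40, 88, 62, 61]]
    (by decide +kernel) (by norm_num)

theorem tiles_n6_81 : Tiles n6 (CompleteRel 81) :=
  tiles_complete 81 1 81 0
    [[12, 49, 6, 0, 31, 33], [14, 12, 10, 62, 50, 19], [73, 5, 19, 20, 27, 2],
     [77, 43, 31, 20, 73, 57]]
    (by decide +kernel) (by norm_num)

theorem tiles_n6_101 : Tiles n6 (CompleteRel 101) :=
  tiles_complete 101 1 101 0
    [[73, 56, 19, 11, 44, 3], [64, 60, 10, 70, 98, 24], [24, 44, 95, 90, 21, 22],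
     [87, 33, 81, 44, 66, 63], [73, 66, 15, 24, 47, 16]]
    (by decide +kernel) (by norm_num)

/-- Here the group has order 33 and moves three runs of points, so the 495 copies form 15 orbits. -/
theorem tiles_n6_100 : Tiles n6 (CompleteRel 100) :=
  tiles_complete 33 3 99 1
    [[46, 62, 6, 70, 74, 57], [76, 44, 7, 11, 17, 99], [26, 45, 28, 58, 84, 43],
     [32, 85, 81, 14, 35, 4], [86, 92, 95, 7, 81, 29], [68, 71, 51, 29, 69, 89],
     [3, 0, 8, 42, 1, 57], [90, 81, 64, 50, 38, 61], [36, 32, 73, 83, 13, 26],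
     [55, 51, 49, 43, 76, 20], [14, 52, 51, 5, 87, 42], [54, 9, 12, 1, 29, 53],
     [87, 25, 91, 4, 74, 65], [87, 17, 58, 43, 91, 95], [83, 90, 75, 41, 14, 60]]
    (by decide +kernel) (by norm_num)

theorem tiles_n8_81 : Tiles n8 (CompleteRel 81) :=
  tiles_complete 81 1 81 0
    [[26, 2, 72, 40, 67, 74], [47, 10, 3, 66, 34, 70], [78, 54, 46, 48, 56, 9],
     [11, 13, 31, 40, 28, 39]]
    (by decide +kernel) (by norm_num)

theorem tiles_n8_101 : Tiles n8 (CompleteRel 101) :=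
  tiles_complete 101 1 101 0
    [[28, 91, 99, 60, 85, 51], [77, 60, 50, 49, 93, 24], [69, 90, 95, 13, 88, 30],
     [72, 84, 69, 30, 34, 17], [8, 25, 29, 45, 7, 97]]
    (by decide +kernel) (by norm_num)

theorem tiles_n8_100 : Tiles n8 (CompleteRel 100) :=
  tiles_complete 33 3 99 1
    [[35, 65, 85, 72, 31, 60], [95, 47, 15, 4, 76, 70], [97, 86, 27, 64, 39, 15],
     [13, 8, 5, 31, 52, 17], [51, 76, 99, 77, 25, 24], [86, 42, 58, 55, 88, 91],
     [30, 37, 33, 2, 55, 63], [45, 62, 24, 97, 48, 14], [22, 67, 84, 77, 52, 97],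
     [93, 80, 59, 12, 17, 69], [76, 61, 52, 88, 32, 70], [10, 24, 8, 31, 30, 70],
     [96, 45, 55, 22, 57, 89], [41, 78, 35, 0, 22, 40], [94, 47, 29, 25, 30, 98]]
    (by decide +kernel) (by norm_num)

theorem tiles_n10_81 : Tiles n10 (CompleteRel 81) :=
  tiles_complete 81 1 81 0
    [[5, 53, 67, 65, 45, 58], [41, 11, 40, 76, 51, 24], [59, 25, 64, 10, 1, 4],
     [27, 70, 77, 64, 74, 50]]
    (by decide +kernel) (by norm_num)

theorem tiles_n10_101 : Tiles n10 (CompleteRel 101) :=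
  tiles_complete 101 1 101 0
    [[88, 1, 29, 4, 61, 99], [98, 51, 42, 94, 16, 50], [55, 33, 70, 54, 3, 84],
     [61, 0, 94, 99, 81, 67], [78, 23, 42, 54, 15, 68]]
    (by decide +kernel) (by norm_num)

theorem tiles_n10_100 : Tiles n10 (CompleteRel 100) :=
  tiles_complete 99 1 99 1
    [[7, 67, 3, 52, 46, 25], [31, 45, 93, 86, 18, 57], [79, 63, 27, 88, 80, 81],
     [32, 2, 72, 44, 67, 99], [94, 72, 5, 6, 85, 97]]
    (by decide +kernel) (by norm_num)

theorem tiles_n13_81 : Tiles n13 (CompleteRel 81) :=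
  tiles_complete 81 1 81 0
    [[15, 67, 59, 63, 5, 35], [59, 24, 27, 19, 42, 21], [3, 45, 71, 14, 70, 6],
     [26, 48, 77, 60, 3, 5]]
    (by decide +kernel) (by norm_num)

theorem tiles_n13_101 : Tiles n13 (CompleteRel 101) :=
  tiles_complete 101 1 101 0
    [[60, 90, 27, 94, 3, 24], [1, 42, 38, 43, 64, 26], [41, 20, 33, 9, 68, 18],
     [17, 62, 56, 11, 4, 27], [96, 2, 23, 98, 42, 78]]
    (by decide +kernel) (by norm_num)

theorem tiles_n13_100 : Tiles n13 (CompleteRel 100) :=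
  tiles_complete 33 3 99 1
    [[81, 10, 19, 47, 58, 65], [4, 27, 74, 3, 20, 77], [49, 66, 25, 52, 45, 22],
     [67, 17, 83, 32, 6, 40], [24, 26, 67, 83, 71, 18], [97, 61, 30, 45, 25, 16],
     [46, 28, 79, 45, 24, 53], [90, 66, 45, 30, 84, 5], [52, 10, 70, 76, 89, 81],
     [16, 28, 54, 63, 60, 29], [53, 43, 78, 27, 22, 91], [70, 63, 35, 91, 7, 59],
     [67, 47, 75, 52, 77, 74], [52, 94, 50, 19, 63, 38], [62, 70, 75, 19, 17, 99]]
    (by decide +kernel) (by norm_num)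

/-! ### Orders 125 and 60 for `n6`, `n8`, `n13`, with the ingredients 25 and 21 -/

theorem tiles_n6_25 : Tiles n6 (CompleteRel 25) :=
  tiles_complete 5 5 25 0
    [[6, 23, 17, 20, 12, 11], [20, 11, 19, 2, 10, 0], [10, 7, 24, 23, 17, 18],
     [1, 0, 3, 5, 22, 16], [23, 5, 15, 18, 8, 19], [12, 2, 7, 8, 4, 14]]
    (by decide +kernel) (by norm_num)

/-- 125 = 5·25: five parts of size 25, each filled with a design of order 25. -/
theorem tiles_n6_125 : Tiles n6 (CompleteRel 125) :=
  tiles_complete_of_multipartite 5 25 5 25 0 0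
    [[43, 104, 108, 77, 98, 80], [68, 9, 13, 102, 123, 105], [93, 34, 38, 7, 4, 10],
     [118, 59, 63, 32, 29, 35], [23, 84, 88, 57, 54, 60], [48, 109, 113, 82, 79, 85],
     [73, 14, 18, 107, 104, 110], [98, 39, 43, 12, 9, 15], [123, 64, 68, 37, 34, 40],
     [4, 89, 93, 62, 59, 65], [29, 114, 118, 87, 84, 90], [54, 19, 23, 112, 109, 115],
     [79, 44, 48, 17, 14, 20], [104, 69, 73, 42, 39, 45], [9, 94, 98, 67, 64, 70],
     [34, 119, 123, 92, 89, 95], [59, 24, 4, 117, 114, 120], [84, 49, 29, 22, 19, 1],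
     [109, 74, 54, 47, 44, 26], [14, 99, 79, 72, 69, 51], [39, 124, 104, 97, 94, 76],
     [64, 0, 9, 122, 119, 101], [89, 25, 34, 3, 24, 6], [114, 50, 59, 28, 49, 31],
     [19, 75, 84, 53, 74, 56], [79, 41, 60, 120, 13, 110], [104, 66, 85, 1, 38, 15],
     [9, 91, 110, 26, 63, 40], [34, 116, 15, 51, 88, 65], [59, 21, 40, 76, 113, 90],
     [84, 46, 65, 101, 18, 115], [109, 71, 90, 6, 43, 20], [14, 96, 115, 31, 68, 45],
     [39, 121, 20, 56, 93, 70], [64, 2, 45, 81, 118, 95], [89, 27, 70, 106, 23, 120],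
     [114, 52, 95, 11, 48, 1], [19, 77, 120, 36, 73, 26], [44, 102, 1, 61, 98, 51],
     [69, 7, 26, 86, 123, 76], [94, 32, 51, 111, 4, 101], [119, 57, 76, 16, 29, 6],
     [24, 82, 101, 41, 54, 31], [49, 107, 6, 66, 79, 56], [74, 12, 31, 91, 104, 81],
     [99, 37, 56, 116, 9, 106], [124, 62, 81, 21, 34, 11], [0, 87, 106, 46, 59, 36],
     [25, 112, 11, 71, 84, 61], [50, 17, 36, 96, 109, 86], [77, 48, 75, 119, 72, 115],
     [102, 73, 100, 24, 97, 20], [7, 98, 5, 49, 122, 45], [32, 123, 30, 74, 3, 70],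
     [57, 4, 55, 99, 28, 95], [82, 29, 80, 124, 53, 120], [107, 54, 105, 0, 78, 1],
     [12, 79, 10, 25, 103, 26], [37, 104, 35, 50, 8, 51], [62, 9, 60, 75, 33, 76],
     [87, 34, 85, 100, 58, 101], [112, 59, 110, 5, 83, 6], [17, 84, 15, 30, 108, 31],
     [42, 109, 40, 55, 13, 56], [67, 14, 65, 80, 38, 81], [92, 39, 90, 105, 63, 106],
     [117, 64, 115, 10, 88, 11], [22, 89, 20, 35, 113, 36], [47, 114, 45, 60, 18, 61],
     [72, 19, 70, 85, 43, 86], [97, 44, 95, 110, 68, 111], [122, 69, 120, 15, 93, 16],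
     [3, 94, 1, 40, 118, 41], [28, 119, 26, 65, 23, 66], [53, 24, 51, 90, 48, 91],
     [55, 23, 2, 49, 102, 76], [80, 48, 27, 74, 7, 101], [105, 73, 52, 99, 32, 6],
     [10, 98, 77, 124, 57, 31], [35, 123, 102, 0, 82, 56], [60, 4, 7, 25, 107, 81],
     [85, 29, 32, 50, 12, 106], [110, 54, 57, 75, 37, 11], [15, 79, 82, 100, 62, 36],
     [40, 104, 107, 5, 87, 61], [65, 9, 12, 30, 112, 86], [90, 34, 37, 55, 17, 111],
     [115, 59, 62, 80, 42, 16], [20, 84, 87, 105, 67, 41], [45, 109, 112, 10, 92, 66],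
     [70, 14, 17, 35, 117, 91], [95, 39, 42, 60, 22, 116], [120, 64, 67, 85, 47, 21],
     [1, 89, 92, 110, 72, 46], [26, 114, 117, 15, 97, 71], [51, 19, 22, 40, 122, 96],
     [76, 44, 47, 65, 3, 121], [101, 69, 72, 90, 28, 2], [6, 94, 97, 115, 53, 27],
     [31, 119, 122, 20, 78, 52], [57, 120, 93, 48, 1, 13], [82, 1, 118, 73, 26, 38],
     [107, 26, 23, 98, 51, 63], [12, 51, 48, 123, 76, 88], [37, 76, 73, 4, 101, 113],
     [62, 101, 98, 29, 6, 18], [87, 6, 123, 54, 31, 43], [112, 31, 4, 79, 56, 68],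
     [17, 56, 29, 104, 81, 93], [42, 81, 54, 9, 106, 118], [67, 106, 79, 34, 11, 23],
     [92, 11, 104, 59, 36, 48], [117, 36, 9, 84, 61, 73], [22, 61, 34, 109, 86, 98],
     [47, 86, 59, 14, 111, 123], [72, 111, 84, 39, 16, 4], [97, 16, 109, 64, 41, 29],
     [122, 41, 14, 89, 66, 54], [3, 66, 39, 114, 91, 79], [28, 91, 64, 19, 116, 104],
     [53, 116, 89, 44, 21, 9], [78, 21, 114, 69, 46, 34], [103, 46, 19, 94, 71, 59],
     [8, 71, 44, 119, 96, 84], [33, 96, 69, 24, 121, 109]]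
    (by decide +kernel) (by norm_num) tiles_n6_25 (Tiles.complete_of_le_one _ (by norm_num))

theorem tiles_n6_21 : Tiles n6 (CompleteRel 21) :=
  tiles_complete 21 1 21 0
    [[18, 0, 1, 14, 2, 12]]
    (by decide +kernel) (by norm_num)

/-- 60 = 39 + 21. Since `t * m` is 52, the hole of 21 points consists of one moved run of 13 points
and 8 fixed points. -/
theorem tiles_n6_60 : Tiles n6 (CompleteRel 60) :=
  tiles_complete_of_hole 13 4 39 21
    [[35, 20, 3, 51, 58, 26], [7, 36, 25, 1, 15, 8], [13, 42, 54, 17, 38, 4],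
     [33, 1, 40, 35, 20, 13], [10, 20, 14, 0, 37, 15], [10, 34, 22, 53, 59, 56],
     [15, 37, 3, 57, 47, 49], [24, 22, 7, 48, 27, 9], [20, 31, 0, 52, 55, 42],
     [29, 43, 34, 3, 35, 37], [44, 21, 42, 14, 5, 35], [26, 9, 5, 41, 39, 1]]
    (by decide +kernel) tiles_n6_21

theorem tiles_n8_25 : Tiles n8 (CompleteRel 25) :=
  tiles_complete 5 5 25 0
    [[12, 6, 14, 5, 1, 18], [9, 2, 19, 6, 15, 23], [24, 10, 17, 14, 19, 9], [24, 3, 6, 23, 0, 10],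
     [22, 13, 16, 4, 24, 18], [2, 8, 24, 1, 12, 17]]
    (by decide +kernel) (by norm_num)

theorem tiles_n8_125 : Tiles n8 (CompleteRel 125) :=
  tiles_complete_of_multipartite 5 25 5 25 0 0
    [[65, 79, 17, 116, 120, 34], [90, 104, 42, 21, 1, 59], [115, 9, 67, 46, 26, 84],
     [20, 34, 92, 71, 51, 109], [45, 59, 117, 96, 76, 14], [70, 84, 22, 121, 101, 39],
     [95, 109, 47, 2, 6, 64], [120, 14, 72, 27, 31, 89], [1, 39, 97, 52, 56, 114],
     [26, 64, 122, 77, 81, 19], [51, 89, 3, 102, 106, 44], [76, 114, 28, 7, 11, 69],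
     [101, 19, 53, 32, 36, 94], [6, 44, 78, 57, 61, 119], [31, 69, 103, 82, 86, 24],
     [56, 94, 8, 107, 111, 49], [81, 119, 33, 12, 16, 74], [106, 24, 58, 37, 41, 99],
     [11, 49, 83, 62, 66, 124], [36, 74, 108, 87, 91, 0], [61, 99, 13, 112, 116, 25],
     [86, 124, 38, 17, 21, 50], [111, 0, 63, 42, 46, 75], [16, 25, 88, 67, 71, 100],
     [41, 50, 113, 92, 96, 5], [63, 68, 91, 16, 106, 87], [88, 93, 116, 41, 11, 112],
     [113, 118, 21, 66, 36, 17], [18, 23, 46, 91, 61, 42], [43, 48, 71, 116, 86, 67],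
     [68, 73, 96, 21, 111, 92], [93, 98, 121, 46, 16, 117], [118, 123, 2, 71, 41, 22],
     [23, 4, 27, 96, 66, 47], [48, 29, 52, 121, 91, 72], [73, 54, 77, 2, 116, 97],
     [98, 79, 102, 27, 21, 122], [123, 104, 7, 52, 46, 3], [4, 9, 32, 77, 71, 28],
     [29, 34, 57, 102, 96, 53], [54, 59, 82, 7, 121, 78], [79, 84, 107, 32, 2, 103],
     [104, 109, 12, 57, 27, 8], [9, 14, 37, 82, 52, 33], [34, 39, 62, 107, 77, 58],
     [59, 64, 87, 12, 102, 83], [84, 89, 112, 37, 7, 108], [109, 114, 17, 62, 32, 13],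
     [14, 19, 42, 87, 57, 38], [39, 44, 67, 112, 82, 63], [66, 55, 3, 82, 116, 41],
     [91, 80, 28, 107, 21, 66], [116, 105, 53, 12, 46, 91], [21, 10, 78, 37, 71, 116],
     [46, 35, 103, 62, 96, 21], [71, 60, 8, 87, 121, 46], [96, 85, 33, 112, 2, 71],
     [121, 110, 58, 17, 27, 96], [2, 15, 83, 42, 52, 121], [27, 40, 108, 67, 77, 2],
     [52, 65, 13, 92, 102, 27], [77, 90, 38, 117, 7, 52], [102, 115, 63, 22, 32, 77],
     [7, 20, 88, 47, 57, 102], [32, 45, 113, 72, 82, 7], [57, 70, 18, 97, 107, 32],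
     [82, 95, 43, 122, 12, 57], [107, 120, 68, 3, 37, 82], [12, 1, 93, 28, 62, 107],
     [37, 26, 118, 53, 87, 12], [62, 51, 23, 78, 112, 37], [87, 76, 48, 103, 17, 62],
     [112, 101, 73, 8, 42, 87], [17, 6, 98, 33, 67, 112], [42, 31, 123, 58, 92, 17],
     [11, 13, 91, 34, 104, 75], [36, 38, 116, 59, 9, 100], [61, 63, 21, 84, 34, 5],
     [86, 88, 46, 109, 59, 30], [111, 113, 71, 14, 84, 55], [16, 18, 96, 39, 109, 80],
     [41, 43, 121, 64, 14, 105], [66, 68, 2, 89, 39, 10], [91, 93, 27, 114, 64, 35],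
     [116, 118, 52, 19, 89, 60], [21, 23, 77, 44, 114, 85], [46, 48, 102, 69, 19, 110],
     [71, 73, 7, 94, 44, 15], [96, 98, 32, 119, 69, 40], [121, 123, 57, 24, 94, 65],
     [2, 4, 82, 49, 119, 90], [27, 29, 107, 74, 24, 115], [52, 54, 12, 99, 49, 20],
     [77, 79, 37, 124, 74, 45], [102, 104, 62, 0, 99, 70], [7, 9, 87, 25, 124, 95],
     [32, 34, 112, 50, 0, 120], [57, 59, 17, 75, 25, 1], [82, 84, 42, 100, 50, 26],
     [107, 109, 67, 5, 75, 51], [0, 50, 76, 110, 114, 49], [25, 75, 101, 15, 19, 74],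
     [50, 100, 6, 40, 44, 99], [75, 5, 31, 65, 69, 124], [100, 30, 56, 90, 94, 0],
     [5, 55, 81, 115, 119, 25], [30, 80, 106, 20, 24, 50], [55, 105, 11, 45, 49, 75],
     [80, 10, 36, 70, 74, 100], [105, 35, 61, 95, 99, 5], [10, 60, 86, 120, 124, 30],
     [35, 85, 111, 1, 0, 55], [60, 110, 16, 26, 25, 80], [85, 15, 41, 51, 50, 105],
     [110, 40, 66, 76, 75, 10], [15, 65, 91, 101, 100, 35], [40, 90, 116, 6, 5, 60],
     [65, 115, 21, 31, 30, 85], [90, 20, 46, 56, 55, 110], [115, 45, 71, 81, 80, 15],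
     [20, 70, 96, 106, 105, 40], [45, 95, 121, 11, 10, 65], [70, 120, 2, 36, 35, 90],
     [95, 1, 27, 61, 60, 115], [120, 26, 52, 86, 85, 20]]
    (by decide +kernel) (by norm_num) tiles_n8_25 (Tiles.complete_of_le_one _ (by norm_num))

theorem tiles_n8_21 : Tiles n8 (CompleteRel 21) :=
  tiles_complete 21 1 21 0
    [[10, 11, 12, 1, 17, 14]]
    (by decide +kernel) (by norm_num)

theorem tiles_n8_60 : Tiles n8 (CompleteRel 60) :=
  tiles_complete_of_hole 13 4 39 21
    [[7, 16, 57, 34, 32, 53], [12, 26, 40, 27, 2, 30], [37, 13, 52, 48, 5, 23],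
     [38, 23, 46, 43, 30, 25], [37, 7, 1, 25, 49, 59], [26, 6, 45, 20, 5, 49],
     [11, 30, 55, 20, 22, 54], [20, 39, 8, 25, 3, 24], [37, 9, 31, 46, 11, 26],
     [12, 34, 58, 56, 19, 25], [46, 48, 22, 1, 33, 16], [8, 20, 41, 14, 37, 4]]
    (by decide +kernel) tiles_n8_21

theorem tiles_n13_25 : Tiles n13 (CompleteRel 25) :=
  tiles_complete 5 5 25 0
    [[19, 7, 24, 21, 15, 1], [11, 23, 1, 7, 8, 3], [17, 11, 19, 12, 2, 10], [12, 23, 5, 20, 22, 7],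
     [10, 4, 18, 3, 9, 24], [18, 7, 21, 8, 4, 2]]
    (by decide +kernel) (by norm_num)

theorem tiles_n13_125 : Tiles n13 (CompleteRel 125) :=
  tiles_complete_of_multipartite 5 25 5 25 0 0
    [[105, 98, 48, 66, 65, 11], [10, 123, 73, 91, 90, 36], [35, 4, 98, 116, 115, 61],
     [60, 29, 123, 21, 20, 86], [85, 54, 4, 46, 45, 111], [110, 79, 29, 71, 70, 16],
     [15, 104, 54, 96, 95, 41], [40, 9, 79, 121, 120, 66], [65, 34, 104, 2, 1, 91],
     [90, 59, 9, 27, 26, 116], [115, 84, 34, 52, 51, 21], [20, 109, 59, 77, 76, 46],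
     [45, 14, 84, 102, 101, 71], [70, 39, 109, 7, 6, 96], [95, 64, 14, 32, 31, 121],
     [120, 89, 39, 57, 56, 2], [1, 114, 64, 82, 81, 27], [26, 19, 89, 107, 106, 52],
     [51, 44, 114, 12, 11, 77], [76, 69, 19, 37, 36, 102], [101, 94, 44, 62, 61, 7],
     [6, 119, 69, 87, 86, 32], [31, 24, 94, 112, 111, 57], [56, 49, 119, 17, 16, 82],
     [81, 74, 24, 42, 41, 107], [62, 12, 100, 107, 46, 41], [87, 37, 5, 12, 71, 66],
     [112, 62, 30, 37, 96, 91], [17, 87, 55, 62, 121, 116], [42, 112, 80, 87, 2, 21],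
     [67, 17, 105, 112, 27, 46], [92, 42, 10, 17, 52, 71], [117, 67, 35, 42, 77, 96],
     [22, 92, 60, 67, 102, 121], [47, 117, 85, 92, 7, 2], [72, 22, 110, 117, 32, 27],
     [97, 47, 15, 22, 57, 52], [122, 72, 40, 47, 82, 77], [3, 97, 65, 72, 107, 102],
     [28, 122, 90, 97, 12, 7], [53, 3, 115, 122, 37, 32], [78, 28, 20, 3, 62, 57],
     [103, 53, 45, 28, 87, 82], [8, 78, 70, 53, 112, 107], [33, 103, 95, 78, 17, 12],
     [58, 8, 120, 103, 42, 37], [83, 33, 1, 8, 67, 62], [108, 58, 26, 33, 92, 87],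
     [13, 83, 51, 58, 117, 112], [38, 108, 76, 83, 22, 17], [104, 93, 81, 66, 51, 28],
     [9, 118, 106, 91, 76, 53], [34, 23, 11, 116, 101, 78], [59, 48, 36, 21, 6, 103],
     [84, 73, 61, 46, 31, 8], [109, 98, 86, 71, 56, 33], [14, 123, 111, 96, 81, 58],
     [39, 4, 16, 121, 106, 83], [64, 29, 41, 2, 11, 108], [89, 54, 66, 27, 36, 13],
     [114, 79, 91, 52, 61, 38], [19, 104, 116, 77, 86, 63], [44, 9, 21, 102, 111, 88],
     [69, 34, 46, 7, 16, 113], [94, 59, 71, 32, 41, 18], [119, 84, 96, 57, 66, 43],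
     [24, 109, 121, 82, 91, 68], [49, 14, 2, 107, 116, 93], [74, 39, 27, 12, 21, 118],
     [99, 64, 52, 37, 46, 23], [124, 89, 77, 62, 71, 48], [0, 114, 102, 87, 96, 73],
     [25, 19, 7, 112, 121, 98], [50, 44, 32, 17, 2, 123], [75, 69, 57, 42, 27, 4],
     [100, 95, 24, 11, 51, 59], [5, 120, 49, 36, 76, 84], [30, 1, 74, 61, 101, 109],
     [55, 26, 99, 86, 6, 14], [80, 51, 124, 111, 31, 39], [105, 76, 0, 16, 56, 64],
     [10, 101, 25, 41, 81, 89], [35, 6, 50, 66, 106, 114], [60, 31, 75, 91, 11, 19],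
     [85, 56, 100, 116, 36, 44], [110, 81, 5, 21, 61, 69], [15, 106, 30, 46, 86, 94],
     [40, 11, 55, 71, 111, 119], [65, 36, 80, 96, 16, 24], [90, 61, 105, 121, 41, 49],
     [115, 86, 10, 2, 66, 74], [20, 111, 35, 27, 91, 99], [45, 16, 60, 52, 116, 124],
     [70, 41, 85, 77, 21, 0], [95, 66, 110, 102, 46, 25], [120, 91, 15, 7, 71, 50],
     [1, 116, 40, 32, 96, 75], [26, 21, 65, 57, 121, 100], [51, 46, 90, 82, 2, 5],
     [76, 71, 115, 107, 27, 30], [57, 80, 0, 33, 38, 98], [82, 105, 25, 58, 63, 123],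
     [107, 10, 50, 83, 88, 4], [12, 35, 75, 108, 113, 29], [37, 60, 100, 13, 18, 54],
     [62, 85, 5, 38, 43, 79], [87, 110, 30, 63, 68, 104], [112, 15, 55, 88, 93, 9],
     [17, 40, 80, 113, 118, 34], [42, 65, 105, 18, 23, 59], [67, 90, 10, 43, 48, 84],
     [92, 115, 35, 68, 73, 109], [117, 20, 60, 93, 98, 14], [22, 45, 85, 118, 123, 39],
     [47, 70, 110, 23, 4, 64], [72, 95, 15, 48, 29, 89], [97, 120, 40, 73, 54, 114],
     [122, 1, 65, 98, 79, 19], [3, 26, 90, 123, 104, 44], [28, 51, 115, 4, 9, 69],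
     [53, 76, 20, 29, 34, 94], [78, 101, 45, 54, 59, 119], [103, 6, 70, 79, 84, 24],
     [8, 31, 95, 104, 109, 49], [33, 56, 120, 9, 14, 74]]
    (by decide +kernel) (by norm_num) tiles_n13_25 (Tiles.complete_of_le_one _ (by norm_num))

theorem tiles_n13_21 : Tiles n13 (CompleteRel 21) :=
  tiles_complete 21 1 21 0
    [[15, 0, 19, 13, 10, 12]]
    (by decide +kernel) (by norm_num)

theorem tiles_n13_60 : Tiles n13 (CompleteRel 60) :=
  tiles_complete_of_hole 13 4 39 21
    [[7, 43, 40, 36, 5, 31], [17, 31, 12, 28, 46, 57], [7, 46, 4, 15, 38, 49],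
     [22, 46, 0, 30, 16, 53], [18, 43, 7, 21, 3, 20], [29, 42, 25, 31, 30, 48],
     [21, 52, 1, 28, 2, 13], [30, 26, 48, 11, 20, 4], [31, 22, 4, 18, 41, 45],
     [10, 27, 24, 33, 54, 55], [11, 41, 59, 21, 15, 33], [30, 58, 5, 14, 10, 56]]
    (by decide +kernel) tiles_n13_21

/-! ### Orders 61, 96, 136 and 140 for `n6` and `n8`, with the ingredients 36 and 40 -/

theorem tiles_n6_61 : Tiles n6 (CompleteRel 61) :=
  tiles_complete 61 1 61 0
    [[51, 25, 15, 27, 7, 45], [6, 2, 32, 21, 54, 7], [56, 49, 60, 33, 46, 28]]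
    (by decide +kernel) (by norm_num)

theorem tiles_n6_36 : Tiles n6 (CompleteRel 36) :=
  tiles_complete 9 4 36 0
    [[16, 14, 12, 8, 17, 33], [1, 8, 26, 27, 22, 33], [7, 2, 32, 16, 31, 9], [0, 24, 5, 25, 6, 27],
     [20, 26, 28, 7, 35, 31], [24, 26, 22, 12, 9, 15], [27, 32, 2, 19, 14, 12]]
    (by decide +kernel) (by norm_num)

/-- 96 = 3·20 + 35 + 1. The part of size 35 is fixed pointwise; with the shared extra point the
parts are filled by designs of orders 21 and 36. -/
theorem tiles_n6_96 : Tiles n6 (CompleteRel 96) :=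
  tiles_complete_of_multipartite 5 12 3 20 35 1
    [[5, 40, 55, 63, 25, 60], [0, 45, 50, 63, 20, 60], [5, 45, 15, 65, 61, 30],
     [0, 40, 10, 65, 61, 35], [20, 10, 5, 55, 64, 62], [25, 15, 0, 50, 64, 62],
     [55, 35, 45, 15, 62, 64], [50, 30, 40, 10, 62, 64], [25, 10, 35, 45, 60, 63],
     [20, 15, 30, 40, 60, 63], [30, 55, 25, 61, 65, 0], [35, 50, 20, 61, 65, 5],
     [5, 42, 57, 69, 26, 66], [0, 47, 52, 69, 21, 66], [5, 47, 15, 71, 67, 31],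
     [0, 42, 10, 71, 67, 36], [21, 10, 5, 57, 70, 68], [26, 15, 0, 52, 70, 68],
     [57, 36, 47, 15, 68, 70], [52, 31, 42, 10, 68, 70], [26, 10, 36, 47, 66, 69],
     [21, 15, 31, 42, 66, 69], [31, 57, 26, 67, 71, 0], [36, 52, 21, 67, 71, 5],
     [5, 44, 59, 75, 27, 72], [0, 49, 54, 75, 22, 72], [5, 49, 15, 77, 73, 32],
     [0, 44, 10, 77, 73, 37], [22, 10, 5, 59, 76, 74], [27, 15, 0, 54, 76, 74],
     [59, 37, 49, 15, 74, 76], [54, 32, 44, 10, 74, 76], [27, 10, 37, 49, 72, 75],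
     [22, 15, 32, 44, 72, 75], [32, 59, 27, 73, 77, 0], [37, 54, 22, 73, 77, 5],
     [5, 41, 56, 81, 28, 78], [0, 46, 51, 81, 23, 78], [5, 46, 15, 83, 79, 33],
     [0, 41, 10, 83, 79, 38], [23, 10, 5, 56, 82, 80], [28, 15, 0, 51, 82, 80],
     [56, 38, 46, 15, 80, 82], [51, 33, 41, 10, 80, 82], [28, 10, 38, 46, 78, 81],
     [23, 15, 33, 41, 78, 81], [33, 56, 28, 79, 83, 0], [38, 51, 23, 79, 83, 5],
     [34, 48, 24, 90, 91, 10], [39, 43, 29, 90, 91, 15], [15, 53, 39, 84, 92, 85],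
     [10, 58, 34, 85, 92, 84], [53, 0, 34, 88, 89, 86], [58, 5, 39, 89, 88, 87],
     [58, 15, 0, 90, 34, 91], [53, 10, 5, 90, 39, 91], [0, 48, 34, 94, 87, 93],
     [5, 43, 39, 94, 86, 93], [43, 0, 29, 85, 92, 84], [48, 5, 24, 84, 92, 85],
     [15, 48, 24, 89, 86, 88], [10, 43, 29, 88, 87, 89], [10, 29, 58, 86, 93, 94],
     [15, 24, 53, 87, 93, 94], [0, 58, 48, 24, 29, 39], [5, 53, 43, 29, 24, 34]]
    (by decide +kernel) (by norm_num) tiles_n6_21 tiles_n6_36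

theorem tiles_n6_136 : Tiles n6 (CompleteRel 136) :=
  tiles_complete_of_multipartite 5 20 5 20 35 1
    [[30, 105, 102, 40, 15, 45], [50, 105, 103, 60, 35, 65], [70, 105, 104, 80, 55, 85],
     [90, 105, 100, 0, 75, 5], [10, 105, 101, 20, 95, 25], [85, 55, 80, 102, 15, 35],
     [5, 75, 0, 103, 35, 55], [25, 95, 20, 104, 55, 75], [45, 15, 40, 100, 75, 95],
     [65, 35, 60, 101, 95, 15], [40, 101, 104, 15, 90, 70], [60, 102, 100, 35, 10, 90],
     [80, 103, 101, 55, 30, 10], [0, 104, 102, 75, 50, 30], [20, 100, 103, 95, 70, 50],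
     [106, 65, 60, 55, 30, 20], [106, 85, 80, 75, 50, 40], [106, 5, 0, 95, 70, 60],
     [106, 25, 20, 15, 90, 80], [106, 45, 40, 35, 10, 0], [15, 90, 25, 103, 50, 70],
     [35, 10, 45, 104, 70, 90], [55, 30, 65, 100, 90, 10], [75, 50, 85, 101, 10, 30],
     [95, 70, 5, 102, 30, 50], [80, 101, 85, 0, 5, 45], [0, 102, 5, 20, 25, 65],
     [20, 103, 25, 40, 45, 85], [40, 104, 45, 60, 65, 5], [60, 100, 65, 80, 85, 25],
     [31, 112, 109, 42, 15, 47], [52, 112, 110, 63, 36, 68], [73, 112, 111, 84, 57, 89],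
     [94, 112, 107, 0, 78, 5], [10, 112, 108, 21, 99, 26], [89, 57, 84, 109, 15, 36],
     [5, 78, 0, 110, 36, 57], [26, 99, 21, 111, 57, 78], [47, 15, 42, 107, 78, 99],
     [68, 36, 63, 108, 99, 15], [42, 108, 111, 15, 94, 73], [63, 109, 107, 36, 10, 94],
     [84, 110, 108, 57, 31, 10], [0, 111, 109, 78, 52, 31], [21, 107, 110, 99, 73, 52],
     [113, 68, 63, 57, 31, 21], [113, 89, 84, 78, 52, 42], [113, 5, 0, 99, 73, 63],
     [113, 26, 21, 15, 94, 84], [113, 47, 42, 36, 10, 0], [15, 94, 26, 110, 52, 73],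
     [36, 10, 47, 111, 73, 94], [57, 31, 68, 107, 94, 10], [78, 52, 89, 108, 10, 31],
     [99, 73, 5, 109, 31, 52], [84, 108, 89, 0, 5, 47], [0, 109, 5, 21, 26, 68],
     [21, 110, 26, 42, 47, 89], [42, 111, 47, 63, 68, 5], [63, 107, 68, 84, 89, 26],
     [32, 119, 116, 44, 15, 49], [54, 119, 117, 61, 37, 66], [71, 119, 118, 83, 59, 88],
     [93, 119, 114, 0, 76, 5], [10, 119, 115, 22, 98, 27], [88, 59, 83, 116, 15, 37],
     [5, 76, 0, 117, 37, 59], [27, 98, 22, 118, 59, 76], [49, 15, 44, 114, 76, 98],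
     [66, 37, 61, 115, 98, 15], [44, 115, 118, 15, 93, 71], [61, 116, 114, 37, 10, 93],
     [83, 117, 115, 59, 32, 10], [0, 118, 116, 76, 54, 32], [22, 114, 117, 98, 71, 54],
     [120, 66, 61, 59, 32, 22], [120, 88, 83, 76, 54, 44], [120, 5, 0, 98, 71, 61],
     [120, 27, 22, 15, 93, 83], [120, 49, 44, 37, 10, 0], [15, 93, 27, 117, 54, 71],
     [37, 10, 49, 118, 71, 93], [59, 32, 66, 114, 93, 10], [76, 54, 88, 115, 10, 32],
     [98, 71, 5, 116, 32, 54], [83, 115, 88, 0, 5, 49], [0, 116, 5, 22, 27, 66],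
     [22, 117, 27, 44, 49, 88], [44, 118, 49, 61, 66, 5], [61, 114, 66, 83, 88, 27],
     [33, 126, 123, 41, 15, 46], [51, 126, 124, 64, 38, 69], [74, 126, 125, 82, 56, 87],
     [92, 126, 121, 0, 79, 5], [10, 126, 122, 23, 97, 28], [87, 56, 82, 123, 15, 38],
     [5, 79, 0, 124, 38, 56], [28, 97, 23, 125, 56, 79], [46, 15, 41, 121, 79, 97],
     [69, 38, 64, 122, 97, 15], [41, 122, 125, 15, 92, 74], [64, 123, 121, 38, 10, 92],
     [82, 124, 122, 56, 33, 10], [0, 125, 123, 79, 51, 33], [23, 121, 124, 97, 74, 51],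
     [127, 69, 64, 56, 33, 23], [127, 87, 82, 79, 51, 41], [127, 5, 0, 97, 74, 64],
     [127, 28, 23, 15, 92, 82], [127, 46, 41, 38, 10, 0], [15, 92, 28, 124, 51, 74],
     [38, 10, 46, 125, 74, 92], [56, 33, 69, 121, 92, 10], [79, 51, 87, 122, 10, 33],
     [97, 74, 5, 123, 33, 51], [82, 122, 87, 0, 5, 46], [0, 123, 5, 23, 28, 69],
     [23, 124, 28, 41, 46, 87], [41, 125, 46, 64, 69, 5], [64, 121, 69, 82, 87, 28],
     [34, 133, 130, 43, 15, 48], [53, 133, 131, 62, 39, 67], [72, 133, 132, 81, 58, 86],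
     [91, 133, 128, 0, 77, 5], [10, 133, 129, 24, 96, 29], [86, 58, 81, 130, 15, 39],
     [5, 77, 0, 131, 39, 58], [29, 96, 24, 132, 58, 77], [48, 15, 43, 128, 77, 96],
     [67, 39, 62, 129, 96, 15], [43, 129, 132, 15, 91, 72], [62, 130, 128, 39, 10, 91],
     [81, 131, 129, 58, 34, 10], [0, 132, 130, 77, 53, 34], [24, 128, 131, 96, 72, 53],
     [134, 67, 62, 58, 34, 24], [134, 86, 81, 77, 53, 43], [134, 5, 0, 96, 72, 62],
     [134, 29, 24, 15, 91, 81], [134, 48, 43, 39, 10, 0], [15, 91, 29, 131, 53, 72],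
     [39, 10, 48, 132, 72, 91], [58, 34, 67, 128, 91, 10], [77, 53, 86, 129, 10, 34],
     [96, 72, 5, 130, 34, 53], [81, 129, 86, 0, 5, 48], [0, 130, 5, 24, 29, 67],
     [24, 131, 29, 43, 48, 86], [43, 132, 48, 62, 67, 5], [62, 128, 67, 81, 86, 29]]
    (by decide +kernel) (by norm_num) tiles_n6_21 tiles_n6_36

theorem tiles_n6_40 : Tiles n6 (CompleteRel 40) :=
  tiles_complete 13 3 39 1
    [[27, 16, 9, 5, 39, 10], [10, 5, 27, 26, 3, 14], [5, 37, 35, 25, 32, 18],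
     [15, 5, 16, 17, 21, 30], [2, 5, 27, 20, 38, 33], [23, 28, 16, 20, 32, 2]]
    (by decide +kernel) (by norm_num)

/-- 140 = 5·20 + 39 + 1, filled with designs of orders 21 and 40. -/
theorem tiles_n6_140 : Tiles n6 (CompleteRel 140) :=
  tiles_complete_of_multipartite 5 20 5 20 39 1
    [[30, 105, 102, 40, 15, 45], [50, 105, 103, 60, 35, 65], [70, 105, 104, 80, 55, 85],
     [90, 105, 100, 0, 75, 5], [10, 105, 101, 20, 95, 25], [85, 55, 80, 102, 15, 35],
     [5, 75, 0, 103, 35, 55], [25, 95, 20, 104, 55, 75], [45, 15, 40, 100, 75, 95],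
     [65, 35, 60, 101, 95, 15], [40, 101, 104, 15, 90, 70], [60, 102, 100, 35, 10, 90],
     [80, 103, 101, 55, 30, 10], [0, 104, 102, 75, 50, 30], [20, 100, 103, 95, 70, 50],
     [106, 65, 60, 55, 30, 20], [106, 85, 80, 75, 50, 40], [106, 5, 0, 95, 70, 60],
     [106, 25, 20, 15, 90, 80], [106, 45, 40, 35, 10, 0], [15, 90, 25, 103, 50, 70],
     [35, 10, 45, 104, 70, 90], [55, 30, 65, 100, 90, 10], [75, 50, 85, 101, 10, 30],
     [95, 70, 5, 102, 30, 50], [80, 101, 85, 0, 5, 45], [0, 102, 5, 20, 25, 65],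
     [20, 103, 25, 40, 45, 85], [40, 104, 45, 60, 65, 5], [60, 100, 65, 80, 85, 25],
     [68, 47, 42, 5, 84, 94], [73, 52, 47, 10, 89, 99], [78, 57, 52, 15, 94, 84],
     [63, 42, 57, 0, 99, 89], [57, 10, 21, 111, 107, 63], [42, 15, 26, 112, 108, 68],
     [47, 0, 31, 113, 109, 73], [52, 5, 36, 114, 110, 78], [26, 109, 31, 94, 84, 52],
     [31, 110, 36, 99, 89, 57], [36, 107, 21, 84, 94, 42], [21, 108, 26, 89, 99, 47],
     [113, 15, 114, 21, 84, 94], [114, 0, 111, 26, 89, 99], [111, 5, 112, 31, 94, 84],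
     [112, 10, 113, 36, 99, 89], [63, 47, 78, 114, 112, 31], [68, 52, 63, 111, 113, 36],
     [73, 57, 68, 112, 114, 21], [78, 42, 73, 113, 111, 26], [111, 36, 110, 47, 15, 0],
     [112, 21, 107, 52, 0, 5], [113, 26, 108, 57, 5, 10], [114, 31, 109, 42, 10, 15],
     [63, 26, 73, 107, 110, 15], [68, 31, 78, 108, 107, 0], [73, 36, 63, 109, 108, 5],
     [78, 21, 68, 110, 109, 10], [108, 0, 63, 52, 84, 94], [109, 5, 68, 57, 89, 99],
     [110, 10, 73, 42, 94, 84], [107, 15, 78, 47, 99, 89], [66, 49, 44, 5, 83, 93],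
     [71, 54, 49, 10, 88, 98], [76, 59, 54, 15, 93, 83], [61, 44, 59, 0, 98, 88],
     [59, 10, 22, 119, 115, 61], [44, 15, 27, 120, 116, 66], [49, 0, 32, 121, 117, 71],
     [54, 5, 37, 122, 118, 76], [27, 117, 32, 93, 83, 54], [32, 118, 37, 98, 88, 59],
     [37, 115, 22, 83, 93, 44], [22, 116, 27, 88, 98, 49], [121, 15, 122, 22, 83, 93],
     [122, 0, 119, 27, 88, 98], [119, 5, 120, 32, 93, 83], [120, 10, 121, 37, 98, 88],
     [61, 49, 76, 122, 120, 32], [66, 54, 61, 119, 121, 37], [71, 59, 66, 120, 122, 22],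
     [76, 44, 71, 121, 119, 27], [119, 37, 118, 49, 15, 0], [120, 22, 115, 54, 0, 5],
     [121, 27, 116, 59, 5, 10], [122, 32, 117, 44, 10, 15], [61, 27, 71, 115, 118, 15],
     [66, 32, 76, 116, 115, 0], [71, 37, 61, 117, 116, 5], [76, 22, 66, 118, 117, 10],
     [116, 0, 61, 54, 83, 93], [117, 5, 66, 59, 88, 98], [118, 10, 71, 44, 93, 83],
     [115, 15, 76, 49, 98, 88], [69, 46, 41, 5, 82, 92], [74, 51, 46, 10, 87, 97],
     [79, 56, 51, 15, 92, 82], [64, 41, 56, 0, 97, 87], [56, 10, 23, 127, 123, 64],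
     [41, 15, 28, 128, 124, 69], [46, 0, 33, 129, 125, 74], [51, 5, 38, 130, 126, 79],
     [28, 125, 33, 92, 82, 51], [33, 126, 38, 97, 87, 56], [38, 123, 23, 82, 92, 41],
     [23, 124, 28, 87, 97, 46], [129, 15, 130, 23, 82, 92], [130, 0, 127, 28, 87, 97],
     [127, 5, 128, 33, 92, 82], [128, 10, 129, 38, 97, 87], [64, 46, 79, 130, 128, 33],
     [69, 51, 64, 127, 129, 38], [74, 56, 69, 128, 130, 23], [79, 41, 74, 129, 127, 28],
     [127, 38, 126, 46, 15, 0], [128, 23, 123, 51, 0, 5], [129, 28, 124, 56, 5, 10],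
     [130, 33, 125, 41, 10, 15], [64, 28, 74, 123, 126, 15], [69, 33, 79, 124, 123, 0],
     [74, 38, 64, 125, 124, 5], [79, 23, 69, 126, 125, 10], [124, 0, 64, 51, 82, 92],
     [125, 5, 69, 56, 87, 97], [126, 10, 74, 41, 92, 82], [123, 15, 79, 46, 97, 87],
     [67, 48, 43, 5, 81, 91], [72, 53, 48, 10, 86, 96], [77, 58, 53, 15, 91, 81],
     [62, 43, 58, 0, 96, 86], [58, 10, 24, 135, 131, 62], [43, 15, 29, 136, 132, 67],
     [48, 0, 34, 137, 133, 72], [53, 5, 39, 138, 134, 77], [29, 133, 34, 91, 81, 53],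
     [34, 134, 39, 96, 86, 58], [39, 131, 24, 81, 91, 43], [24, 132, 29, 86, 96, 48],
     [137, 15, 138, 24, 81, 91], [138, 0, 135, 29, 86, 96], [135, 5, 136, 34, 91, 81],
     [136, 10, 137, 39, 96, 86], [62, 48, 77, 138, 136, 34], [67, 53, 62, 135, 137, 39],
     [72, 58, 67, 136, 138, 24], [77, 43, 72, 137, 135, 29], [135, 39, 134, 48, 15, 0],
     [136, 24, 131, 53, 0, 5], [137, 29, 132, 58, 5, 10], [138, 34, 133, 43, 10, 15],
     [62, 29, 72, 131, 134, 15], [67, 34, 77, 132, 131, 0], [72, 39, 62, 133, 132, 5],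
     [77, 24, 67, 134, 133, 10], [132, 0, 62, 53, 81, 91], [133, 5, 67, 58, 86, 96],
     [134, 10, 72, 43, 91, 81], [131, 15, 77, 48, 96, 86]]
    (by decide +kernel) (by norm_num) tiles_n6_21 tiles_n6_40

theorem tiles_n8_61 : Tiles n8 (CompleteRel 61) :=
  tiles_complete 61 1 61 0
    [[59, 55, 52, 53, 27, 38], [46, 60, 4, 19, 15, 11], [58, 49, 40, 35, 1, 59]]
    (by decide +kernel) (by norm_num)

theorem tiles_n8_36 : Tiles n8 (CompleteRel 36) :=
  tiles_complete 9 4 36 0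
    [[29, 23, 27, 17, 16, 0], [21, 26, 1, 17, 4, 2], [2, 15, 11, 23, 4, 20],
     [6, 35, 34, 16, 11, 32], [32, 29, 20, 7, 24, 2], [27, 16, 3, 9, 4, 10],
     [20, 19, 30, 21, 35, 9]]
    (by decide +kernel) (by norm_num)

theorem tiles_n8_96 : Tiles n8 (CompleteRel 96) :=
  tiles_complete_of_multipartite 5 12 3 20 35 1
    [[30, 25, 65, 60, 45, 50], [35, 20, 65, 60, 40, 55], [15, 5, 20, 40, 64, 60],
     [10, 0, 25, 45, 64, 60], [5, 15, 35, 65, 63, 50], [0, 10, 30, 65, 63, 55],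
     [50, 40, 0, 62, 61, 10], [55, 45, 5, 62, 61, 15], [20, 35, 10, 0, 61, 62],
     [25, 30, 15, 5, 61, 62], [50, 45, 20, 64, 63, 35], [55, 40, 25, 64, 63, 30],
     [31, 26, 71, 66, 47, 52], [36, 21, 71, 66, 42, 57], [15, 5, 21, 42, 70, 66],
     [10, 0, 26, 47, 70, 66], [5, 15, 36, 71, 69, 52], [0, 10, 31, 71, 69, 57],
     [52, 42, 0, 68, 67, 10], [57, 47, 5, 68, 67, 15], [21, 36, 10, 0, 67, 68],
     [26, 31, 15, 5, 67, 68], [52, 47, 21, 70, 69, 36], [57, 42, 26, 70, 69, 31],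
     [32, 27, 77, 72, 49, 54], [37, 22, 77, 72, 44, 59], [15, 5, 22, 44, 76, 72],
     [10, 0, 27, 49, 76, 72], [5, 15, 37, 77, 75, 54], [0, 10, 32, 77, 75, 59],
     [54, 44, 0, 74, 73, 10], [59, 49, 5, 74, 73, 15], [22, 37, 10, 0, 73, 74],
     [27, 32, 15, 5, 73, 74], [54, 49, 22, 76, 75, 37], [59, 44, 27, 76, 75, 32],
     [33, 28, 83, 78, 46, 51], [38, 23, 83, 78, 41, 56], [15, 5, 23, 41, 82, 78],
     [10, 0, 28, 46, 82, 78], [5, 15, 38, 83, 81, 51], [0, 10, 33, 83, 81, 56],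
     [51, 41, 0, 80, 79, 10], [56, 46, 5, 80, 79, 15], [23, 38, 10, 0, 79, 80],
     [28, 33, 15, 5, 79, 80], [51, 46, 23, 82, 81, 38], [56, 41, 28, 82, 81, 33],
     [91, 88, 58, 24, 10, 53], [92, 89, 15, 43, 34, 10], [90, 87, 39, 0, 53, 34],
     [39, 34, 84, 86, 10, 48], [58, 53, 85, 84, 34, 5], [15, 10, 86, 85, 53, 29],
     [94, 93, 53, 58, 29, 24], [94, 93, 10, 15, 48, 43], [94, 93, 34, 39, 5, 0],
     [89, 92, 53, 58, 0, 39], [87, 90, 10, 15, 24, 58], [88, 91, 34, 39, 43, 15],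
     [48, 24, 84, 85, 15, 0], [5, 43, 85, 86, 39, 24], [29, 0, 86, 84, 58, 43],
     [87, 90, 29, 43, 48, 5], [88, 91, 48, 0, 5, 29], [89, 92, 5, 24, 29, 48]]
    (by decide +kernel) (by norm_num) tiles_n8_21 tiles_n8_36

theorem tiles_n8_136 : Tiles n8 (CompleteRel 136) :=
  tiles_complete_of_multipartite 5 20 5 20 35 1
    [[102, 106, 0, 85, 70, 55], [103, 106, 20, 5, 90, 75], [104, 106, 40, 25, 10, 95],
     [100, 106, 60, 45, 30, 15], [101, 106, 80, 65, 50, 35], [95, 5, 50, 30, 35, 101],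
     [15, 25, 70, 50, 55, 102], [35, 45, 90, 70, 75, 103], [55, 65, 10, 90, 95, 104],
     [75, 85, 30, 10, 15, 100], [70, 0, 104, 80, 30, 100], [90, 20, 100, 0, 50, 101],
     [10, 40, 101, 20, 70, 102], [30, 60, 102, 40, 90, 103], [50, 80, 103, 60, 10, 104],
     [10, 105, 60, 25, 35, 90], [30, 105, 80, 45, 55, 10], [50, 105, 0, 65, 75, 30],
     [70, 105, 20, 85, 95, 50], [90, 105, 40, 5, 15, 70], [35, 5, 40, 102, 85, 45],
     [55, 25, 60, 103, 5, 65], [75, 45, 80, 104, 25, 85], [95, 65, 0, 100, 45, 5],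
     [15, 85, 20, 101, 65, 25], [101, 20, 75, 60, 55, 45], [102, 40, 95, 80, 75, 65],
     [103, 60, 15, 0, 95, 85], [104, 80, 35, 20, 15, 5], [100, 0, 55, 40, 35, 25],
     [109, 113, 0, 89, 73, 57], [110, 113, 21, 5, 94, 78], [111, 113, 42, 26, 10, 99],
     [107, 113, 63, 47, 31, 15], [108, 113, 84, 68, 52, 36], [99, 5, 52, 31, 36, 108],
     [15, 26, 73, 52, 57, 109], [36, 47, 94, 73, 78, 110], [57, 68, 10, 94, 99, 111],
     [78, 89, 31, 10, 15, 107], [73, 0, 111, 84, 31, 107], [94, 21, 107, 0, 52, 108],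
     [10, 42, 108, 21, 73, 109], [31, 63, 109, 42, 94, 110], [52, 84, 110, 63, 10, 111],
     [10, 112, 63, 26, 36, 94], [31, 112, 84, 47, 57, 10], [52, 112, 0, 68, 78, 31],
     [73, 112, 21, 89, 99, 52], [94, 112, 42, 5, 15, 73], [36, 5, 42, 109, 89, 47],
     [57, 26, 63, 110, 5, 68], [78, 47, 84, 111, 26, 89], [99, 68, 0, 107, 47, 5],
     [15, 89, 21, 108, 68, 26], [108, 21, 78, 63, 57, 47], [109, 42, 99, 84, 78, 68],
     [110, 63, 15, 0, 99, 89], [111, 84, 36, 21, 15, 5], [107, 0, 57, 42, 36, 26],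
     [116, 120, 0, 88, 71, 59], [117, 120, 22, 5, 93, 76], [118, 120, 44, 27, 10, 98],
     [114, 120, 61, 49, 32, 15], [115, 120, 83, 66, 54, 37], [98, 5, 54, 32, 37, 115],
     [15, 27, 71, 54, 59, 116], [37, 49, 93, 71, 76, 117], [59, 66, 10, 93, 98, 118],
     [76, 88, 32, 10, 15, 114], [71, 0, 118, 83, 32, 114], [93, 22, 114, 0, 54, 115],
     [10, 44, 115, 22, 71, 116], [32, 61, 116, 44, 93, 117], [54, 83, 117, 61, 10, 118],
     [10, 119, 61, 27, 37, 93], [32, 119, 83, 49, 59, 10], [54, 119, 0, 66, 76, 32],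
     [71, 119, 22, 88, 98, 54], [93, 119, 44, 5, 15, 71], [37, 5, 44, 116, 88, 49],
     [59, 27, 61, 117, 5, 66], [76, 49, 83, 118, 27, 88], [98, 66, 0, 114, 49, 5],
     [15, 88, 22, 115, 66, 27], [115, 22, 76, 61, 59, 49], [116, 44, 98, 83, 76, 66],
     [117, 61, 15, 0, 98, 88], [118, 83, 37, 22, 15, 5], [114, 0, 59, 44, 37, 27],
     [123, 127, 0, 87, 74, 56], [124, 127, 23, 5, 92, 79], [125, 127, 41, 28, 10, 97],
     [121, 127, 64, 46, 33, 15], [122, 127, 82, 69, 51, 38], [97, 5, 51, 33, 38, 122],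
     [15, 28, 74, 51, 56, 123], [38, 46, 92, 74, 79, 124], [56, 69, 10, 92, 97, 125],
     [79, 87, 33, 10, 15, 121], [74, 0, 125, 82, 33, 121], [92, 23, 121, 0, 51, 122],
     [10, 41, 122, 23, 74, 123], [33, 64, 123, 41, 92, 124], [51, 82, 124, 64, 10, 125],
     [10, 126, 64, 28, 38, 92], [33, 126, 82, 46, 56, 10], [51, 126, 0, 69, 79, 33],
     [74, 126, 23, 87, 97, 51], [92, 126, 41, 5, 15, 74], [38, 5, 41, 123, 87, 46],
     [56, 28, 64, 124, 5, 69], [79, 46, 82, 125, 28, 87], [97, 69, 0, 121, 46, 5],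
     [15, 87, 23, 122, 69, 28], [122, 23, 79, 64, 56, 46], [123, 41, 97, 82, 79, 69],
     [124, 64, 15, 0, 97, 87], [125, 82, 38, 23, 15, 5], [121, 0, 56, 41, 38, 28],
     [130, 134, 0, 86, 72, 58], [131, 134, 24, 5, 91, 77], [132, 134, 43, 29, 10, 96],
     [128, 134, 62, 48, 34, 15], [129, 134, 81, 67, 53, 39], [96, 5, 53, 34, 39, 129],
     [15, 29, 72, 53, 58, 130], [39, 48, 91, 72, 77, 131], [58, 67, 10, 91, 96, 132],
     [77, 86, 34, 10, 15, 128], [72, 0, 132, 81, 34, 128], [91, 24, 128, 0, 53, 129],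
     [10, 43, 129, 24, 72, 130], [34, 62, 130, 43, 91, 131], [53, 81, 131, 62, 10, 132],
     [10, 133, 62, 29, 39, 91], [34, 133, 81, 48, 58, 10], [53, 133, 0, 67, 77, 34],
     [72, 133, 24, 86, 96, 53], [91, 133, 43, 5, 15, 72], [39, 5, 43, 130, 86, 48],
     [58, 29, 62, 131, 5, 67], [77, 48, 81, 132, 29, 86], [96, 67, 0, 128, 48, 5],
     [15, 86, 24, 129, 67, 29], [129, 24, 77, 62, 58, 48], [130, 43, 96, 81, 77, 67],
     [131, 62, 15, 0, 96, 86], [132, 81, 39, 24, 15, 5], [128, 0, 58, 43, 39, 29]]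
    (by decide +kernel) (by norm_num) tiles_n8_21 tiles_n8_36

theorem tiles_n8_40 : Tiles n8 (CompleteRel 40) :=
  tiles_complete 13 3 39 1
    [[24, 4, 6, 39, 13, 29], [38, 29, 1, 8, 30, 25], [25, 14, 17, 21, 1, 28],
     [14, 33, 29, 35, 26, 0], [9, 18, 28, 3, 19, 12], [10, 17, 5, 36, 28, 9]]
    (by decide +kernel) (by norm_num)

theorem tiles_n8_140 : Tiles n8 (CompleteRel 140) :=
  tiles_complete_of_multipartite 5 20 5 20 39 1
    [[102, 106, 0, 85, 70, 55], [103, 106, 20, 5, 90, 75], [104, 106, 40, 25, 10, 95],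
     [100, 106, 60, 45, 30, 15], [101, 106, 80, 65, 50, 35], [95, 5, 50, 30, 35, 101],
     [15, 25, 70, 50, 55, 102], [35, 45, 90, 70, 75, 103], [55, 65, 10, 90, 95, 104],
     [75, 85, 30, 10, 15, 100], [70, 0, 104, 80, 30, 100], [90, 20, 100, 0, 50, 101],
     [10, 40, 101, 20, 70, 102], [30, 60, 102, 40, 90, 103], [50, 80, 103, 60, 10, 104],
     [10, 105, 60, 25, 35, 90], [30, 105, 80, 45, 55, 10], [50, 105, 0, 65, 75, 30],
     [70, 105, 20, 85, 95, 50], [90, 105, 40, 5, 15, 70], [35, 5, 40, 102, 85, 45],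
     [55, 25, 60, 103, 5, 65], [75, 45, 80, 104, 25, 85], [95, 65, 0, 100, 45, 5],
     [15, 85, 20, 101, 65, 25], [101, 20, 75, 60, 55, 45], [102, 40, 95, 80, 75, 65],
     [103, 60, 15, 0, 95, 85], [104, 80, 35, 20, 15, 5], [100, 0, 55, 40, 35, 25],
     [10, 0, 68, 89, 84, 63], [15, 5, 73, 94, 89, 68], [0, 10, 78, 99, 94, 73],
     [5, 15, 63, 84, 99, 78], [89, 78, 31, 108, 42, 21], [94, 63, 36, 109, 47, 26],
     [99, 68, 21, 110, 52, 31], [84, 73, 26, 107, 57, 36], [73, 84, 109, 21, 52, 42],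
     [78, 89, 110, 26, 57, 47], [63, 94, 107, 31, 42, 52], [68, 99, 108, 36, 47, 57],
     [10, 0, 31, 57, 108, 111], [15, 5, 36, 42, 109, 112], [0, 10, 21, 47, 110, 113],
     [5, 15, 26, 52, 107, 114], [110, 108, 73, 42, 94, 36], [107, 109, 78, 47, 99, 21],
     [108, 110, 63, 52, 84, 26], [109, 107, 68, 57, 89, 31], [111, 113, 68, 36, 99, 52],
     [112, 114, 73, 21, 84, 57], [113, 111, 78, 26, 89, 42], [114, 112, 63, 31, 94, 47],
     [63, 94, 111, 57, 21, 113], [68, 99, 112, 42, 26, 114], [73, 84, 113, 47, 31, 111],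
     [78, 89, 114, 52, 36, 112], [0, 10, 107, 26, 52, 114], [5, 15, 108, 31, 57, 111],
     [10, 0, 109, 36, 42, 112], [15, 5, 110, 21, 47, 113], [10, 0, 66, 88, 83, 61],
     [15, 5, 71, 93, 88, 66], [0, 10, 76, 98, 93, 71], [5, 15, 61, 83, 98, 76],
     [88, 76, 32, 116, 44, 22], [93, 61, 37, 117, 49, 27], [98, 66, 22, 118, 54, 32],
     [83, 71, 27, 115, 59, 37], [71, 83, 117, 22, 54, 44], [76, 88, 118, 27, 59, 49],
     [61, 93, 115, 32, 44, 54], [66, 98, 116, 37, 49, 59], [10, 0, 32, 59, 116, 119],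
     [15, 5, 37, 44, 117, 120], [0, 10, 22, 49, 118, 121], [5, 15, 27, 54, 115, 122],
     [118, 116, 71, 44, 93, 37], [115, 117, 76, 49, 98, 22], [116, 118, 61, 54, 83, 27],
     [117, 115, 66, 59, 88, 32], [119, 121, 66, 37, 98, 54], [120, 122, 71, 22, 83, 59],
     [121, 119, 76, 27, 88, 44], [122, 120, 61, 32, 93, 49], [61, 93, 119, 59, 22, 121],
     [66, 98, 120, 44, 27, 122], [71, 83, 121, 49, 32, 119], [76, 88, 122, 54, 37, 120],
     [0, 10, 115, 27, 54, 122], [5, 15, 116, 32, 59, 119], [10, 0, 117, 37, 44, 120],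
     [15, 5, 118, 22, 49, 121], [10, 0, 69, 87, 82, 64], [15, 5, 74, 92, 87, 69],
     [0, 10, 79, 97, 92, 74], [5, 15, 64, 82, 97, 79], [87, 79, 33, 124, 41, 23],
     [92, 64, 38, 125, 46, 28], [97, 69, 23, 126, 51, 33], [82, 74, 28, 123, 56, 38],
     [74, 82, 125, 23, 51, 41], [79, 87, 126, 28, 56, 46], [64, 92, 123, 33, 41, 51],
     [69, 97, 124, 38, 46, 56], [10, 0, 33, 56, 124, 127], [15, 5, 38, 41, 125, 128],
     [0, 10, 23, 46, 126, 129], [5, 15, 28, 51, 123, 130], [126, 124, 74, 41, 92, 38],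
     [123, 125, 79, 46, 97, 23], [124, 126, 64, 51, 82, 28], [125, 123, 69, 56, 87, 33],
     [127, 129, 69, 38, 97, 51], [128, 130, 74, 23, 82, 56], [129, 127, 79, 28, 87, 41],
     [130, 128, 64, 33, 92, 46], [64, 92, 127, 56, 23, 129], [69, 97, 128, 41, 28, 130],
     [74, 82, 129, 46, 33, 127], [79, 87, 130, 51, 38, 128], [0, 10, 123, 28, 51, 130],
     [5, 15, 124, 33, 56, 127], [10, 0, 125, 38, 41, 128], [15, 5, 126, 23, 46, 129],
     [10, 0, 67, 86, 81, 62], [15, 5, 72, 91, 86, 67], [0, 10, 77, 96, 91, 72],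
     [5, 15, 62, 81, 96, 77], [86, 77, 34, 132, 43, 24], [91, 62, 39, 133, 48, 29],
     [96, 67, 24, 134, 53, 34], [81, 72, 29, 131, 58, 39], [72, 81, 133, 24, 53, 43],
     [77, 86, 134, 29, 58, 48], [62, 91, 131, 34, 43, 53], [67, 96, 132, 39, 48, 58],
     [10, 0, 34, 58, 132, 135], [15, 5, 39, 43, 133, 136], [0, 10, 24, 48, 134, 137],
     [5, 15, 29, 53, 131, 138], [134, 132, 72, 43, 91, 39], [131, 133, 77, 48, 96, 24],
     [132, 134, 62, 53, 81, 29], [133, 131, 67, 58, 86, 34], [135, 137, 67, 39, 96, 53],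
     [136, 138, 72, 24, 81, 58], [137, 135, 77, 29, 86, 43], [138, 136, 62, 34, 91, 48],
     [62, 91, 135, 58, 24, 137], [67, 96, 136, 43, 29, 138], [72, 81, 137, 48, 34, 135],
     [77, 86, 138, 53, 39, 136], [0, 10, 131, 29, 53, 138], [5, 15, 132, 34, 58, 135],
     [10, 0, 133, 39, 43, 136], [15, 5, 134, 24, 48, 137]]
    (by decide +kernel) (by norm_num) tiles_n8_21 tiles_n8_40

/-! ### Orders 125, 140, 105 and 136 for `n3` and `n10` -/

/-- The required 775 copies cannot be split into regular orbits of length 125 or 124, but 775 =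
25·31, so four runs of 31 points and one fixed point are used. -/
theorem tiles_n3_125 : Tiles n3 (CompleteRel 125) :=
  tiles_complete 31 4 124 1
    [[110, 66, 107, 21, 86, 114], [84, 23, 114, 14, 40, 111], [23, 119, 124, 51, 71, 13],
     [94, 110, 103, 26, 38, 12], [54, 109, 96, 56, 73, 100], [106, 117, 112, 19, 77, 48],
     [115, 116, 9, 52, 77, 101], [87, 24, 68, 30, 33, 15], [57, 61, 3, 67, 60, 111],
     [17, 122, 114, 3, 19, 9], [49, 17, 119, 37, 31, 89], [66, 68, 99, 39, 26, 15],
     [111, 64, 121, 123, 89, 33], [11, 105, 36, 85, 15, 50], [32, 1, 54, 19, 17, 66],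
     [43, 122, 76, 10, 79, 95], [81, 118, 51, 57, 4, 89], [59, 81, 39, 21, 71, 73],
     [64, 33, 14, 56, 79, 36], [23, 16, 52, 28, 78, 90], [86, 62, 3, 104, 6, 105],
     [52, 31, 111, 36, 45, 102], [29, 108, 83, 32, 30, 114], [66, 80, 75, 79, 59, 100],
     [33, 81, 3, 95, 23, 89]]
    (by decide +kernel) (by norm_num)

theorem tiles_n3_140 : Tiles n3 (CompleteRel 140) :=
  tiles_complete 139 1 139 1
    [[74, 16, 13, 133, 138, 101], [108, 38, 88, 40, 67, 138], [51, 79, 0, 5, 104, 14],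
     [88, 52, 95, 101, 12, 16], [134, 135, 40, 7, 50, 102], [26, 3, 108, 126, 134, 139],
     [138, 61, 37, 134, 46, 86]]
    (by decide +kernel) (by norm_num)

/-- The number 546 of copies is not a multiple of 105, but 546 = 26·21 allows a group of order 21.
-/
theorem tiles_n3_105 : Tiles n3 (CompleteRel 105) :=
  tiles_complete 21 5 105 0
    [[46, 53, 65, 42, 10, 95], [13, 53, 3, 61, 67, 19], [19, 68, 41, 58, 99, 20],
     [38, 102, 33, 59, 42, 6], [25, 92, 2, 71, 16, 53], [22, 79, 40, 16, 80, 31],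
     [93, 68, 73, 70, 79, 76], [72, 42, 12, 7, 57, 88], [44, 3, 29, 12, 16, 95],
     [89, 100, 103, 47, 37, 2], [4, 35, 22, 6, 24, 58], [59, 28, 84, 60, 47, 57],
     [39, 99, 51, 72, 20, 96], [24, 28, 3, 77, 75, 86], [68, 12, 24, 46, 9, 0],
     [95, 2, 6, 94, 63, 23], [65, 22, 87, 49, 72, 62], [79, 17, 103, 59, 98, 62],
     [49, 74, 29, 36, 104, 76], [4, 83, 75, 71, 88, 86], [101, 33, 88, 47, 27, 86],
     [4, 39, 98, 89, 70, 87], [72, 54, 30, 59, 31, 38], [52, 92, 88, 14, 80, 63],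
     [80, 7, 51, 98, 54, 24], [42, 94, 17, 92, 24, 26]]
    (by decide +kernel) (by norm_num)

theorem tiles_n3_136 : Tiles n3 (CompleteRel 136) :=
  tiles_complete 27 5 135 1
    [[121, 116, 76, 57, 52, 49], [0, 50, 117, 3, 110, 62], [25, 130, 61, 59, 53, 10],
     [27, 115, 29, 23, 60, 85], [13, 47, 70, 42, 91, 15], [29, 76, 90, 77, 47, 21],
     [67, 99, 37, 20, 33, 60], [14, 120, 41, 23, 44, 135], [62, 110, 127, 12, 123, 19],
     [69, 118, 93, 60, 43, 120], [102, 119, 72, 135, 92, 126], [11, 53, 131, 36, 115, 27],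
     [69, 96, 87, 27, 24, 94], [47, 60, 23, 130, 63, 56], [35, 47, 27, 48, 127, 135],
     [132, 94, 39, 66, 78, 84], [99, 6, 19, 11, 122, 113], [109, 74, 28, 18, 110, 25],
     [116, 64, 70, 53, 75, 8], [18, 82, 71, 11, 131, 77], [126, 81, 114, 14, 106, 28],
     [64, 10, 6, 106, 32, 15], [102, 15, 67, 117, 98, 50], [72, 125, 94, 26, 82, 1],
     [115, 85, 121, 124, 113, 58], [130, 96, 104, 29, 93, 74], [88, 13, 54, 83, 32, 29],
     [35, 14, 103, 80, 46, 89], [31, 19, 96, 115, 128, 72], [83, 96, 57, 47, 32, 112],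
     [44, 91, 90, 97, 6, 3], [124, 3, 84, 39, 2, 23], [56, 66, 1, 79, 102, 68],
     [7, 99, 13, 23, 55, 47]]
    (by decide +kernel) (by norm_num)

theorem tiles_n10_125 : Tiles n10 (CompleteRel 125) :=
  tiles_complete 31 4 124 1
    [[15, 86, 114, 26, 18, 96], [37, 107, 5, 18, 109, 74], [93, 110, 30, 86, 27, 51],
     [44, 87, 3, 9, 119, 59], [68, 30, 16, 117, 78, 26], [88, 104, 49, 71, 94, 2],
     [103, 34, 91, 42, 19, 8], [97, 19, 76, 122, 59, 68], [114, 124, 88, 14, 50, 78],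
     [87, 122, 57, 85, 88, 72], [37, 92, 38, 112, 59, 24], [33, 15, 25, 36, 30, 104],
     [53, 99, 119, 74, 118, 10], [20, 86, 81, 1, 77, 21], [24, 100, 116, 38, 36, 106],
     [91, 51, 83, 70, 76, 55], [85, 41, 10, 58, 87, 21], [11, 36, 117, 108, 60, 38],
     [25, 49, 53, 58, 69, 88], [107, 120, 67, 53, 33, 2], [38, 18, 56, 22, 44, 9],
     [60, 112, 64, 54, 105, 119], [17, 94, 75, 8, 10, 24], [105, 102, 110, 12, 42, 78],
     [116, 86, 74, 85, 4, 120]]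
    (by decide +kernel) (by norm_num)

theorem tiles_n10_140 : Tiles n10 (CompleteRel 140) :=
  tiles_complete 139 1 139 1
    [[60, 24, 21, 10, 107, 32], [126, 6, 116, 96, 32, 102], [21, 37, 81, 54, 46, 25],
     [92, 11, 18, 79, 16, 139], [108, 86, 14, 20, 32, 3], [72, 49, 129, 97, 28, 103],
     [83, 21, 68, 120, 22, 40]]
    (by decide +kernel) (by norm_num)

theorem tiles_n10_105 : Tiles n10 (CompleteRel 105) :=
  tiles_complete 21 5 105 0
    [[78, 1, 48, 19, 99, 77], [6, 30, 46, 51, 84, 7], [41, 94, 81, 54, 0, 87],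
     [75, 72, 33, 53, 68, 77], [24, 43, 77, 51, 26, 38], [1, 87, 18, 65, 79, 39],
     [80, 48, 69, 22, 41, 87], [55, 31, 22, 103, 35, 9], [16, 98, 6, 99, 42, 53],
     [37, 81, 36, 8, 2, 95], [51, 20, 55, 41, 26, 67], [17, 79, 98, 27, 103, 28],
     [52, 91, 49, 50, 27, 42], [77, 82, 102, 36, 69, 100], [86, 58, 84, 52, 75, 21],
     [57, 88, 43, 101, 32, 9], [26, 4, 104, 89, 73, 29], [68, 100, 39, 13, 4, 32],
     [72, 89, 98, 1, 71, 43], [71, 17, 85, 33, 95, 57], [95, 25, 36, 0, 16, 74],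
     [104, 58, 87, 101, 17, 68], [52, 80, 14, 37, 32, 72], [52, 22, 77, 3, 10, 34],
     [73, 1, 61, 64, 79, 42], [1, 44, 14, 56, 12, 66]]
    (by decide +kernel) (by norm_num)

theorem tiles_n10_136 : Tiles n10 (CompleteRel 136) :=
  tiles_complete 27 5 135 1
    [[109, 49, 132, 44, 105, 77], [42, 108, 85, 15, 72, 80], [34, 11, 4, 119, 113, 9],
     [105, 78, 59, 68, 39, 0], [124, 84, 113, 88, 44, 48], [22, 38, 65, 107, 72, 59],
     [98, 4, 5, 19, 52, 41], [5, 0, 77, 9, 82, 15], [93, 95, 75, 70, 9, 134],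
     [48, 123, 72, 42, 124, 71], [106, 22, 112, 109, 20, 80], [71, 104, 128, 38, 93, 18],
     [52, 114, 67, 88, 8, 69], [124, 25, 87, 132, 63, 23], [103, 110, 54, 12, 6, 4],
     [60, 39, 64, 61, 119, 44], [82, 106, 47, 75, 84, 70], [66, 94, 82, 11, 19, 135],
     [116, 109, 37, 68, 56, 72], [58, 125, 64, 12, 27, 0], [133, 38, 89, 108, 41, 12],
     [105, 98, 99, 120, 110, 76], [119, 124, 110, 19, 51, 28], [46, 2, 47, 18, 65, 7],
     [102, 133, 21, 61, 29, 48], [14, 70, 124, 109, 81, 74], [121, 135, 101, 25, 51, 75],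
     [54, 0, 124, 40, 92, 118], [49, 94, 102, 25, 85, 90], [26, 94, 36, 45, 47, 129],
     [81, 20, 64, 94, 29, 48], [128, 66, 17, 68, 79, 78], [131, 30, 66, 53, 40, 55],
     [47, 32, 25, 39, 1, 93]]
    (by decide +kernel) (by norm_num)

/-! ### Remaining orders: `n6` of 105 and 80, `n8` of 80, `n13` of 80 and 140 -/

theorem tiles_n6_105 : Tiles n6 (CompleteRel 105) :=
  tiles_complete_of_multipartite 7 15 5 21 0 0
    [[91, 28, 49, 0, 7, 14], [98, 35, 56, 7, 14, 0], [84, 21, 42, 14, 0, 7],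
     [28, 98, 14, 63, 77, 70], [35, 84, 0, 70, 63, 77], [21, 91, 7, 77, 70, 63],
     [21, 98, 77, 56, 49, 42], [28, 84, 63, 42, 56, 49], [35, 91, 70, 49, 42, 56],
     [95, 29, 51, 0, 7, 14], [102, 36, 58, 7, 14, 0], [88, 22, 44, 14, 0, 7],
     [29, 102, 14, 66, 80, 73], [36, 88, 0, 73, 66, 80], [22, 95, 7, 80, 73, 66],
     [22, 102, 80, 58, 51, 44], [29, 88, 66, 44, 58, 51], [36, 95, 73, 51, 44, 58],
     [92, 30, 53, 0, 7, 14], [99, 37, 60, 7, 14, 0], [85, 23, 46, 14, 0, 7],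
     [30, 99, 14, 69, 83, 76], [37, 85, 0, 76, 69, 83], [23, 92, 7, 83, 76, 69],
     [23, 99, 83, 60, 53, 46], [30, 85, 69, 46, 60, 53], [37, 92, 76, 53, 46, 60],
     [96, 31, 55, 0, 7, 14], [103, 38, 62, 7, 14, 0], [89, 24, 48, 14, 0, 7],
     [31, 103, 14, 65, 79, 72], [38, 89, 0, 72, 65, 79], [24, 96, 7, 79, 72, 65],
     [24, 103, 79, 62, 55, 48], [31, 89, 65, 48, 62, 55], [38, 96, 72, 55, 48, 62],
     [93, 32, 50, 0, 7, 14], [100, 39, 57, 7, 14, 0], [86, 25, 43, 14, 0, 7],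
     [32, 100, 14, 68, 82, 75], [39, 86, 0, 75, 68, 82], [25, 93, 7, 82, 75, 68],
     [25, 100, 82, 57, 50, 43], [32, 86, 68, 43, 57, 50], [39, 93, 75, 50, 43, 57],
     [97, 33, 52, 0, 7, 14], [104, 40, 59, 7, 14, 0], [90, 26, 45, 14, 0, 7],
     [33, 104, 14, 64, 78, 71], [40, 90, 0, 71, 64, 78], [26, 97, 7, 78, 71, 64],
     [26, 104, 78, 59, 52, 45], [33, 90, 64, 45, 59, 52], [40, 97, 71, 52, 45, 59],
     [94, 34, 54, 0, 7, 14], [101, 41, 61, 7, 14, 0], [87, 27, 47, 14, 0, 7],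
     [34, 101, 14, 67, 81, 74], [41, 87, 0, 74, 67, 81], [27, 94, 7, 81, 74, 67],
     [27, 101, 81, 61, 54, 47], [34, 87, 67, 47, 61, 54], [41, 94, 74, 54, 47, 61]]
    (by decide +kernel) (by norm_num) tiles_n6_21 (Tiles.complete_of_le_one _ (by norm_num))

theorem tiles_n6_41 : Tiles n6 (CompleteRel 41) :=
  tiles_complete 41 1 41 0
    [[20, 10, 38, 32, 25, 13], [36, 18, 8, 4, 16, 19]]
    (by decide +kernel) (by norm_num)

theorem tiles_n6_80 : Tiles n6 (CompleteRel 80) :=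
  tiles_complete_of_hole 13 6 39 41
    [[8, 22, 28, 36, 69, 40], [34, 16, 14, 23, 55, 63], [48, 15, 39, 16, 28, 6],
     [26, 29, 35, 54, 71, 39], [25, 15, 12, 31, 63, 70], [3, 23, 10, 51, 76, 47],
     [29, 51, 54, 25, 4, 21], [20, 8, 6, 25, 60, 71], [24, 22, 36, 1, 76, 9],
     [24, 36, 10, 79, 56, 78], [5, 1, 19, 41, 63, 62], [38, 1, 71, 2, 7, 34],
     [2, 32, 31, 55, 58, 62], [7, 18, 16, 66, 45, 75], [36, 21, 3, 70, 42, 58],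
     [2, 7, 21, 5, 77, 28], [33, 27, 36, 41, 71, 66], [42, 17, 28, 27, 26, 12]]
    (by decide +kernel) tiles_n6_41

theorem tiles_n13_80 : Tiles n13 (CompleteRel 80) :=
  tiles_complete_of_hole 11 7 55 25
    [[61, 1, 41, 23, 15, 32], [62, 14, 46, 36, 23, 41], [65, 31, 6, 53, 36, 46],
     [63, 38, 18, 5, 53, 6], [57, 48, 32, 15, 5, 18], [75, 20, 26, 30, 33, 51],
     [71, 27, 34, 35, 44, 10], [70, 37, 47, 50, 0, 19], [67, 45, 9, 7, 11, 24],
     [69, 3, 16, 21, 22, 39], [13, 51, 71, 65, 25, 14], [28, 10, 70, 63, 42, 31],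
     [40, 19, 67, 57, 49, 38], [54, 24, 69, 61, 4, 48], [8, 39, 75, 62, 12, 1],
     [27, 75, 32, 47, 45, 31], [37, 71, 41, 9, 3, 38], [45, 70, 46, 16, 20, 48],
     [3, 67, 6, 26, 27, 1], [20, 69, 18, 34, 37, 14], [77, 27, 45, 20, 37, 3],
     [78, 23, 53, 15, 36, 5], [79, 28, 54, 13, 40, 8], [55, 44, 11, 33, 0, 22],
     [55, 42, 4, 25, 49, 12], [55, 51, 19, 39, 10, 24]]
    (by decide +kernel) tiles_n13_25

/-- With `m = 1` the group is trivial, and all 19 copies are listed. -/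
theorem tiles_n8_20 : Tiles n8 (CompleteRel 20) :=
  tiles_complete 1 20 20 0
    [[14, 12, 10, 7, 9, 0], [15, 13, 11, 6, 8, 1], [8, 11, 12, 7, 14, 1], [9, 10, 13, 6, 15, 0],
     [5, 4, 11, 14, 9, 2], [4, 5, 10, 15, 8, 3], [1, 6, 14, 2, 3, 12], [0, 7, 15, 3, 2, 13],
     [19, 18, 7, 0, 9, 11], [19, 18, 6, 1, 8, 10], [17, 16, 1, 6, 9, 11], [16, 17, 0, 7, 8, 10],
     [4, 5, 13, 19, 12, 18], [19, 18, 3, 16, 2, 17], [4, 5, 7, 1, 6, 0], [17, 16, 5, 15, 4, 14],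
     [2, 3, 10, 9, 11, 8], [19, 18, 14, 15, 13, 12], [17, 16, 12, 13, 3, 2]]
    (by decide +kernel) (by norm_num)

theorem tiles_n8_80 : Tiles n8 (CompleteRel 80) :=
  tiles_complete_of_multipartite 20 4 4 20 0 0
    [[1, 18, 44, 77, 28, 26], [21, 38, 64, 18, 48, 46], [41, 58, 5, 38, 68, 66],
     [61, 78, 25, 58, 9, 7], [78, 65, 20, 12, 54, 21], [19, 6, 40, 32, 74, 41],
     [39, 26, 60, 52, 15, 61], [59, 46, 1, 72, 35, 2], [32, 29, 51, 44, 11, 61],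
     [52, 49, 71, 64, 31, 2], [72, 69, 12, 5, 51, 22], [13, 10, 32, 25, 71, 42]]
    (by decide +kernel) (by norm_num) tiles_n8_20 (Tiles.complete_of_le_one _ (by norm_num))

theorem tiles_n13_41 : Tiles n13 (CompleteRel 41) :=
  tiles_complete 41 1 41 0
    [[30, 10, 21, 14, 23, 24], [38, 24, 15, 2, 23, 26]]
    (by decide +kernel) (by norm_num)

/-- 140 = 99 + 41. The hole of 41 points consists of one moved run of 11 points and 30 fixed points.
-/
theorem tiles_n13_140 : Tiles n13 (CompleteRel 140) :=
  tiles_complete_of_hole 11 10 99 41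
    [[62, 85, 3, 120, 31, 9], [73, 96, 14, 121, 42, 20], [84, 9, 25, 119, 53, 31],
     [95, 20, 36, 120, 64, 42], [8, 31, 47, 121, 75, 53], [19, 42, 58, 119, 86, 64],
     [30, 53, 69, 120, 97, 75], [41, 64, 80, 121, 10, 86], [52, 75, 91, 119, 21, 97],
     [24, 64, 138, 25, 54, 38], [35, 75, 139, 36, 65, 49], [46, 86, 137, 47, 76, 60],
     [57, 97, 138, 58, 87, 71], [68, 10, 139, 69, 98, 82], [79, 21, 137, 80, 0, 93],
     [90, 32, 138, 91, 11, 6], [3, 43, 139, 4, 22, 17], [14, 54, 137, 15, 33, 28],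
     [82, 89, 56, 76, 32, 116], [93, 2, 67, 87, 43, 117], [6, 13, 78, 98, 54, 118],
     [17, 24, 89, 0, 65, 116], [28, 35, 2, 11, 76, 117], [39, 46, 13, 22, 87, 118],
     [50, 57, 24, 33, 98, 116], [61, 68, 35, 44, 0, 117], [72, 79, 46, 55, 11, 118],
     [109, 70, 13, 37, 50, 40], [103, 81, 24, 48, 61, 51], [108, 92, 35, 59, 72, 62],
     [102, 5, 46, 70, 83, 73], [107, 16, 57, 81, 94, 84], [101, 27, 68, 92, 7, 95],
     [106, 38, 79, 5, 18, 8], [100, 49, 90, 16, 29, 19], [105, 60, 3, 27, 40, 30],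
     [97, 34, 127, 133, 7, 77], [10, 45, 125, 131, 18, 88], [21, 56, 126, 132, 29, 1],
     [32, 67, 127, 133, 40, 12], [43, 78, 125, 131, 51, 23], [54, 89, 126, 132, 62, 34],
     [65, 2, 127, 133, 73, 45], [76, 13, 125, 131, 84, 56], [87, 24, 126, 132, 95, 67],
     [5, 67, 47, 101, 88, 81], [16, 78, 58, 106, 1, 92], [27, 89, 69, 100, 12, 5],
     [38, 2, 80, 105, 23, 16], [49, 13, 91, 99, 34, 27], [60, 24, 4, 104, 45, 38],
     [71, 35, 15, 109, 56, 49], [82, 46, 26, 103, 67, 60], [93, 57, 37, 108, 78, 71],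
     [59, 63, 41, 47, 100, 113], [70, 74, 52, 58, 105, 114], [81, 85, 63, 69, 99, 115],
     [92, 96, 74, 80, 104, 113], [5, 9, 85, 91, 109, 114], [16, 20, 96, 4, 103, 115],
     [27, 31, 9, 15, 108, 113], [38, 42, 20, 26, 102, 114], [49, 53, 31, 37, 107, 115],
     [66, 134, 11, 30, 77, 111], [77, 135, 22, 41, 88, 112], [88, 136, 33, 52, 1, 110],
     [1, 134, 44, 63, 12, 111], [12, 135, 55, 74, 23, 112], [23, 136, 66, 85, 34, 110],
     [34, 134, 77, 96, 45, 111], [45, 135, 88, 9, 56, 112], [56, 136, 1, 20, 67, 110],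
     [64, 39, 13, 129, 122, 15], [75, 50, 24, 130, 123, 26], [86, 61, 35, 128, 124, 37],
     [97, 72, 46, 129, 122, 48], [10, 83, 57, 130, 123, 59], [21, 94, 68, 128, 124, 70],
     [32, 7, 79, 129, 122, 81], [43, 18, 90, 130, 123, 92], [54, 29, 3, 128, 124, 5]]
    (by decide +kernel) tiles_n13_41

/-! ### Absence of isolated vertices, and the conclusion -/

theorem exists_adj_n3 : ∀ a, ∃ b, n3.Adj a b := by
  simp only [n3, graphOfEdges_adj]
  decide

theorem exists_adj_n6 : ∀ a, ∃ b, n6.Adj a b := by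
  simp only [n6, graphOfEdges_adj]
  decide

theorem exists_adj_n8 : ∀ a, ∃ b, n8.Adj a b := by
  simp only [n8, graphOfEdges_adj]
  decide

theorem exists_adj_n10 : ∀ a, ∃ b, n10.Adj a b := by
  simp only [n10, graphOfEdges_adj]
  decide

theorem exists_adj_n13 : ∀ a, ∃ b, n13.Adj a b := by
  simp only [n13, graphOfEdges_adj]
  decide

theorem lemma3p3 :
    (∀ G ∈ ({n3, n6, n8, n10, n13} : Set (SimpleGraph (Fin 6))),
      ∀ n ∈ ({100, 140, 81, 101, 125} : Set ℕ), HasDesign G n) ∧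
    (∀ G ∈ ({n6, n8, n13} : Set (SimpleGraph (Fin 6))),
      ∀ n ∈ ({60, 80} : Set ℕ), HasDesign G n) ∧
    (∀ G ∈ ({n6, n8} : Set (SimpleGraph (Fin 6))), HasDesign G 61) ∧
    (∀ G ∈ ({n3, n6, n10} : Set (SimpleGraph (Fin 6))), HasDesign G 105) ∧
    (∀ G ∈ ({n6, n8} : Set (SimpleGraph (Fin 6))), HasDesign G 96) ∧
    (∀ G ∈ ({n3, n6, n8, n10} : Set (SimpleGraph (Fin 6))), HasDesign G 136) := by
  refine ⟨?_, ?_, ?_, ?_, ?_, ?_⟩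
  · rintro G (rfl | rfl | rfl | rfl | rfl) n (rfl | rfl | rfl | rfl | rfl)
    · exact tiles_n3_100.hasDesign exists_adj_n3
    · exact tiles_n3_140.hasDesign exists_adj_n3
    · exact tiles_n3_81.hasDesign exists_adj_n3
    · exact tiles_n3_101.hasDesign exists_adj_n3
    · exact tiles_n3_125.hasDesign exists_adj_n3
    · exact tiles_n6_100.hasDesign exists_adj_n6
    · exact tiles_n6_140.hasDesign exists_adj_n6
    · exact tiles_n6_81.hasDesign exists_adj_n6
    · exact tiles_n6_101.hasDesign exists_adj_n6
    · exact tiles_n6_125.hasDesign exists_adj_n6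
    · exact tiles_n8_100.hasDesign exists_adj_n8
    · exact tiles_n8_140.hasDesign exists_adj_n8
    · exact tiles_n8_81.hasDesign exists_adj_n8
    · exact tiles_n8_101.hasDesign exists_adj_n8
    · exact tiles_n8_125.hasDesign exists_adj_n8
    · exact tiles_n10_100.hasDesign exists_adj_n10
    · exact tiles_n10_140.hasDesign exists_adj_n10
    · exact tiles_n10_81.hasDesign exists_adj_n10
    · exact tiles_n10_101.hasDesign exists_adj_n10
    · exact tiles_n10_125.hasDesign exists_adj_n10
    · exact tiles_n13_100.hasDesign exists_adj_n13
    · exact tiles_n13_140.hasDesign exists_adj_n13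
    · exact tiles_n13_81.hasDesign exists_adj_n13
    · exact tiles_n13_101.hasDesign exists_adj_n13
    · exact tiles_n13_125.hasDesign exists_adj_n13
  · rintro G (rfl | rfl | rfl) n (rfl | rfl)
    · exact tiles_n6_60.hasDesign exists_adj_n6
    · exact tiles_n6_80.hasDesign exists_adj_n6
    · exact tiles_n8_60.hasDesign exists_adj_n8
    · exact tiles_n8_80.hasDesign exists_adj_n8
    · exact tiles_n13_60.hasDesign exists_adj_n13
    · exact tiles_n13_80.hasDesign exists_adj_n13
  · rintro G (rfl | rfl)
    · exact tiles_n6_61.hasDesign exists_adj_n6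
    · exact tiles_n8_61.hasDesign exists_adj_n8
  · rintro G (rfl | rfl | rfl)
    · exact tiles_n3_105.hasDesign exists_adj_n3
    · exact tiles_n6_105.hasDesign exists_adj_n6
    · exact tiles_n10_105.hasDesign exists_adj_n10
  · rintro G (rfl | rfl)
    · exact tiles_n6_96.hasDesign exists_adj_n6
    · exact tiles_n8_96.hasDesign exists_adj_n8
  · rintro G (rfl | rfl | rfl | rfl)
    · exact tiles_n3_136.hasDesign exists_adj_n3
    · exact tiles_n6_136.hasDesign exists_adj_n6
    · exact tiles_n8_136.hasDesign exists_adj_n8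
    · exact tiles_n10_136.hasDesign exists_adj_n10
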